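/- Let $\mathbb H$ be the quaternions and $\mathbb H[[z]]$ the ring of formal power series $f=\sum_{k\ge0} f_kz^k$ with quaternionic coefficients, $z$ commuting with the coefficients; put $f^\sharp=\sum_k \overline{f_k}z^k$ and $\|f\|^2=\sum_k|f_k|^2\in[0,\infty]$. The Schur class $\mathcal S_{\mathbb H}$ consists of all $f$ with $\|fh\|\le\|h\|$ for every $h$ with $\|h\|<\infty$. Let $\mathcal H_1=\{f:\limsup_k|f_k|^{1/k}\le1\}$. For $f\in\mathcal H_1$, a point $\gamma$ with $|\gamma|<1$ is a left (right) zero of $f$ if $\sum_k\gamma^kf_k=0$ (respectively $\sum_kf_k\gamma^k=0$); a zero is a left or a right zero. For $|\alpha|<1$ put ${\bf b}_\alpha=(z-\alpha)(1-z\overline\alpha)^{-1}$. A finite Blaschke product is a series ${\bf b}_{\alpha_1}\cdots{\bf b}_{\alpha_n}\phi$ with $n\ge0$, $|\alpha_j|<1$, $|\phi|=1$; it is called normalized if it can be written in this way with $\phi=1$. Let $[\alpha]=\{h\alpha h^{-1}:h\in\mathbb H\setminus\{0\}\}$. For $V=[\alpha]$ with $\alpha$ non-real and $|\alpha|<1$,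 put $\mathcal X_V=z^2-2z\,\mathrm{Re}\,\alpha+|\alpha|^2$ and $\mathcal B_V={\bf b}_\alpha{\bf b}_{\alpha}^\sharp$ (these depend on $V$ only). Such a $V$ is a spherical zero of $g\in\mathcal H_1$ if it contains two distinct left zeros or two distinct right zeros of $g$, and $m_s(V;f)=n$ means that $f=\mathcal X_V^n g$ for some $g\in\mathcal H_1$ for which $V$ is not a spherical zero. A real $x\in(-1,1)$ is a zero of $f$ of multiplicity $\pi$ if $f=(z-x)^\pi g$ for some $g\in\mathcal H_1$ with no zero at $x$. A spherical chain in $V$ is a finite sequence $(\alpha_1,\dots,\alpha_k)$ in $V$ with $\alpha_{j+1}\ne\overline{\alpha_j}$ for $j=1,\dots,k-1$. **Theorem.** Let $f\in\mathcal S_{\mathbb H}$, $f\neq0$, and let $V$ be a similarity class containing a zero of $f$. Then there exist unique normalized finite Blaschke products $B_{\ell,V}$ and $B_{r,V}$ with all zeros in $V$ such that $$f=B_{\ell,V}H_V=G_VB_{r,V}$$ for some $H_V,G_V\in\mathcal S_{\mathbb H}$ having no zeros in $V$. Among all finite Blaschke products, $B_{\ell,V}$ is unique up to a unimodular constant factor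 on the right, and $B_{r,V}$ up to a unimodular constant factor on the left. More precisely: 1. If $V=\{x\}$ with $x$ real, then $x$ is a zero of $f$ of some multiplicity $\pi\ge1$, and $B_{\ell,V}=B_{r,V}={\bf b}_x^\pi$. If $V$ is the class of a non-real quaternion, then $m_s(V;f)$ and $m_s(V;ff^\sharp)$ exist, $m_s(V;ff^\sharp)\ge 2m_s(V;f)$ and $m_s(V;ff^\sharp)>0$, and: 2. If $m_s(V;ff^\sharp)=2m_s(V;f)=2\kappa>0$, then $B_{\ell,V}=B_{r,V}=\mathcal B_V^\kappa$. 3. If $m_s(V;f)=\kappa\ge0$ and $m_s(V;ff^\sharp)-2m_s(V;f)=k>0$, then there exist unique spherical chains $(\alpha_1,\dots,\alpha_k)$ and $(\widetilde\alpha_1,\dots,\widetilde\alpha_k)$ in $V$ such that $$B_{\ell,V}=\mathcal B_V^\kappa\,{\bf b}_{\alpha_1}\cdots{\bf b}_{\alpha_k}\quad\text{and}\quad B_{r,V}={\bf b}_{\widetilde\alpha_k}\cdots{\bf b}_{\widetilde\alpha_1}\,\mathcal B_V^\kappa.$$ -/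

import Mathlib

open scoped Quaternion ENNReal

namespace QSchur

/-- The ring of formal power series with quaternionic coefficients in a variable `z`
that commutes with the coefficients (the product is the Cauchy product). -/
abbrev QSeries : Type := PowerSeries ℍ[ℝ]

/-- The involution `f ↦ f♯` conjugating all the coefficients. -/
noncomputable def sharp (f : QSeries) : QSeries :=
  PowerSeries.mk fun k => star (PowerSeries.coeff k f)

/-- Membership in `ℋ₁`: `limsup |f_k|^(1/k) ≤ 1` (computed in `[0, ∞]`). -/
def InH1 (f : QSeries) : Prop :=
  Filter.limsup (fun k : ℕ => ‖PowerSeries.coeff k f‖ₑ ^ (1 / (k : ℝ))) Filter.atTop ≤ 1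

/-- Left evaluation `∑ γ^k f_k`. -/
noncomputable def leftEval (f : QSeries) (γ : ℍ[ℝ]) : ℍ[ℝ] :=
  ∑' k : ℕ, γ ^ k * PowerSeries.coeff k f

/-- Right evaluation `∑ f_k γ^k`. -/
noncomputable def rightEval (f : QSeries) (γ : ℍ[ℝ]) : ℍ[ℝ] :=
  ∑' k : ℕ, PowerSeries.coeff k f * γ ^ k

/-- Left zeros in the open unit ball (used for series in `ℋ₁`). -/
def IsLeftZero (f : QSeries) (γ : ℍ[ℝ]) : Prop := ‖γ‖ < 1 ∧ leftEval f γ = 0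

/-- Right zeros in the open unit ball (used for series in `ℋ₁`). -/
def IsRightZero (f : QSeries) (γ : ℍ[ℝ]) : Prop := ‖γ‖ < 1 ∧ rightEval f γ = 0

/-- A zero is a left zero or a right zero. -/
def IsZero (f : QSeries) (γ : ℍ[ℝ]) : Prop := IsLeftZero f γ ∨ IsRightZero f γ

/-- The squared norm `∑ |f_k|²` of the Hardy space, with value `∞` outside of the space. -/
noncomputable def hardyNormSq (f : QSeries) : ℝ≥0∞ :=
  ∑' k : ℕ, ‖PowerSeries.coeff k f‖ₑ ^ 2

/-- The Schur class: contractive (left) multipliers of the Hardy space. -/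
def IsSchur (f : QSeries) : Prop :=
  ∀ h : QSeries, hardyNormSq h < ∞ → hardyNormSq (f * h) ≤ hardyNormSq h

/-- The similarity class `[α]`. -/
def simClass (α : ℍ[ℝ]) : Set ℍ[ℝ] := {β | ∃ h : ℍ[ℝ], h ≠ 0 ∧ β = h * α * h⁻¹}

/-- The polynomial `z - α`. -/
noncomputable def rho (α : ℍ[ℝ]) : QSeries := PowerSeries.X - PowerSeries.C α

/-- The series `∑ ᾱ^k z^k`, the inverse of `1 - z ᾱ`. -/
noncomputable def kern (α : ℍ[ℝ]) : QSeries := PowerSeries.mk fun k => star α ^ k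

/-- The Blaschke factor `(z - α)(1 - z ᾱ)⁻¹`. -/
noncomputable def blaschke (α : ℍ[ℝ]) : QSeries := rho α * kern α

/-- The polynomial `z² - 2 z Re α + |α|²` of the sphere `[α]`. -/
noncomputable def sphPoly (α : ℍ[ℝ]) : QSeries :=
  PowerSeries.X ^ 2 - PowerSeries.C ((2 * α.re : ℝ) : ℍ[ℝ]) * PowerSeries.X
    + PowerSeries.C ((‖α‖ ^ 2 : ℝ) : ℍ[ℝ])

/-- The Blaschke factor of the sphere `[α]`. -/
noncomputable def sphBlaschke (α : ℍ[ℝ]) : QSeries := blaschke α * sharp (blaschke α)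

/-- Products `b_{α₁} ⋯ b_{αₙ}` of finitely many Blaschke factors (`1` if `n = 0`). -/
def IsBlaschkeProd (B : QSeries) : Prop :=
  ∃ l : List ℍ[ℝ], (∀ a ∈ l, ‖a‖ < 1) ∧ B = (l.map blaschke).prod

/-- Finite Blaschke products `b_{α₁} ⋯ b_{αₙ} φ` with a unimodular constant `φ`. -/
def IsFiniteBlaschke (B : QSeries) : Prop :=
  ∃ P : QSeries, IsBlaschkeProd P ∧ ∃ φ : ℍ[ℝ], ‖φ‖ = 1 ∧ B = P * PowerSeries.C φ

/-- All (left and right) zeros of `B` lie in `V`. -/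
def ZerosIn (B : QSeries) (V : Set ℍ[ℝ]) : Prop := ∀ γ, IsZero B γ → γ ∈ V

/-- `H` has neither left nor right zeros in `V`. -/
def NoZerosIn (H : QSeries) (V : Set ℍ[ℝ]) : Prop := ∀ γ ∈ V, ¬ IsZero H γ

/-- `B` is a finite Blaschke product with all zeros in `V`, and `f = B H` for some
Schur-class `H` without zeros in `V`. -/
def IsLeftBlaschkeDivisor (f : QSeries) (V : Set ℍ[ℝ]) (B : QSeries) : Prop :=
  IsFiniteBlaschke B ∧ ZerosIn B V ∧ ∃ H : QSeries, IsSchur H ∧ NoZerosIn H V ∧ f = B * H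

/-- `B` is a finite Blaschke product with all zeros in `V`, and `f = G B` for some
Schur-class `G` without zeros in `V`. -/
def IsRightBlaschkeDivisor (f : QSeries) (V : Set ℍ[ℝ]) (B : QSeries) : Prop :=
  IsFiniteBlaschke B ∧ ZerosIn B V ∧ ∃ G : QSeries, IsSchur G ∧ NoZerosIn G V ∧ f = G * B

/-- The real point `x` has multiplicity `n` for `f`: `f = (z - x)^n g`, where `g ∈ ℋ₁` has
no zero at `x`. -/
def HasRealMult (f : QSeries) (x : ℝ) (n : ℕ) : Prop :=
  ∃ g : QSeries, InH1 g ∧ ¬ IsZero g (x : ℍ[ℝ]) ∧ f = rho (x : ℍ[ℝ]) ^ n * g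

/-- `V` is a spherical zero of `f`: it contains two distinct left zeros or two distinct right
zeros of `f`. -/
def IsSphericalZero (f : QSeries) (V : Set ℍ[ℝ]) : Prop :=
  (∃ β ∈ V, ∃ γ ∈ V, β ≠ γ ∧ IsLeftZero f β ∧ IsLeftZero f γ) ∨
    (∃ β ∈ V, ∃ γ ∈ V, β ≠ γ ∧ IsRightZero f β ∧ IsRightZero f γ)

/-- The sphere `[α]` (`α` not real) has spherical multiplicity `n` for `f`: `f = 𝒳^n g` with
`𝒳` the polynomial of the sphere, where `g ∈ ℋ₁` and `[α]` is not a spherical zero of `g`. -/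
def HasSphMult (f : QSeries) (α : ℍ[ℝ]) (n : ℕ) : Prop :=
  ∃ g : QSeries, InH1 g ∧ ¬ IsSphericalZero g (simClass α) ∧ f = sphPoly α ^ n * g

/-- Spherical chains in the similarity class `V`: consecutive elements are not
conjugates of each other. -/
def IsSphericalChain (V : Set ℍ[ℝ]) (l : List ℍ[ℝ]) : Prop :=
  (∀ a ∈ l, a ∈ V) ∧ l.IsChain fun a b => b ≠ star a

end QSchur

open QSchur

/-! A left zero `a` of a Schur series `f` can be divided out inside the class: `f = b_a H` with `H`
again Schur (`IsSchur.exists_eq_blaschke_mul`). Extracting zeros in `V` stops after finitely many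
steps, since each factor multiplies the lowest coefficient of the product by a number of modulus
`‖a‖ < 1`, whereas that of `f` is fixed and nonzero; if `V = {0}`, the order of vanishing at the
origin bounds the number of factors. What remains has no left zeros in `V`, and hence no right zeros
there, because both kinds are detected by the central series `f f♯`.

Uniqueness rests on one fact about a class: if `γ ≠ β` in `V` is a left zero of `b_β g`, then `β̄`
is a left zero of `g`, whatever `γ` is (`leftEval_star_eq_zero`). Together with `b_β b_β̄ = ℬ_V =
b_γ b_γ̄`, it allows any left zero in `V` of the product to be moved to the front, so that two
factorizations can be peeled simultaneously (`prod_eq_prod_of_mul_eq`).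

Cancelling adjacent conjugate pairs into the central `ℬ_V` leaves a spherical chain. A nonempty
chain product times a zero-free series has only the head of the chain as left zero in `V`
(`eq_head_of_leftEval_eq_zero`). Therefore the chain can be read off, and no further spherical
factor divides the product: `m_s(V;f)` counts the cancelled pairs. As `B B♯` is `ℬ_V` to the number
of factors of `B`, `m_s(V;ff♯)` counts all the factors. The right-hand statements are the left-hand
ones for `f♯`. -/

namespace QSchur
open PowerSeries

/-! ### The involution and real series -/

@[simp]
theorem coeff_sharp (k : ℕ) (f : QSeries) : coeff k (sharp f) = star (coeff k f) := by
  simp [sharp]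

@[simp]
theorem sharp_sharp (f : QSeries) : sharp (sharp f) = f := by
  ext1 k; simp

theorem sharp_injective : Function.Injective sharp := fun f g h => by
  rw [← sharp_sharp f, h, sharp_sharp]

theorem sharp_mul (f g : QSeries) : sharp (f * g) = sharp g * sharp f := by
  ext1 k
  simp only [coeff_sharp, coeff_mul, star_sum, star_mul]
  rw [← Finset.Nat.sum_antidiagonal_swap]
  rfl

@[simp]
theorem sharp_one : sharp 1 = 1 := by
  ext1 k
  simp only [coeff_sharp, coeff_one]
  split_ifs <;> simp

@[simp]
theorem sharp_zero : sharp 0 = 0 := by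
  ext1 k; simp

@[simp]
theorem sharp_C (a : ℍ[ℝ]) : sharp (C a) = C (star a) := by
  ext1 k
  simp only [coeff_sharp, coeff_C]
  split_ifs <;> simp

@[simp]
theorem sharp_rho (a : ℍ[ℝ]) : sharp (rho a) = rho (star a) := by
  ext1 k
  simp only [coeff_sharp, rho, map_sub, coeff_C, coeff_X, star_sub]
  split_ifs <;> simp

theorem sharp_kern (a : ℍ[ℝ]) : sharp (kern a) = kern (star a) := by
  ext1 k
  simp [kern]

theorem sharp_pow (f : QSeries) (n : ℕ) : sharp (f ^ n) = sharp f ^ n := by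
  induction n with
  | zero => simp
  | succ n ih => rw [pow_succ, sharp_mul, ih, ← pow_succ']

theorem commute_of_star_eq {a : ℍ[ℝ]} (ha : star a = a) (b : ℍ[ℝ]) : Commute a b := by
  obtain ⟨x, rfl⟩ : ∃ x : ℝ, a = x := by
    refine ⟨a.re, ?_⟩
    exact Quaternion.eq_re_iff_mem_range_coe.2 (by
      rw [Quaternion.star_eq_self.1 ha]; exact ⟨_, rfl⟩)
  exact Quaternion.coe_commutes x b

/-- A series fixed by the involution has real coefficients. The centrality of `f f♯`, `𝒳_V` and
`ℬ_V` comes from here. -/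
theorem commute_of_sharp_eq {f : QSeries} (hf : sharp f = f) (g : QSeries) : Commute f g := by
  ext1 k
  rw [coeff_mul, coeff_mul, ← Finset.Nat.sum_antidiagonal_swap]
  refine Finset.sum_congr rfl fun p _ => ?_
  exact commute_of_star_eq (by rw [← coeff_sharp, hf]) _

theorem sharp_mul_sharp_self (f : QSeries) : sharp (f * sharp f) = f * sharp f := by
  rw [sharp_mul, sharp_sharp]

/-- Both products have real coefficients, and the real part of a product of two quaternions does not
depend on their order. -/
theorem sharp_mul_self (f : QSeries) : sharp f * f = f * sharp f := by
  have h : ∀ g : QSeries, ∀ k, coeff k (g * sharp g)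
      = ((∑ p ∈ Finset.HasAntidiagonal.antidiagonal k, (coeff p.1 g * star (coeff p.2 g)).re : ℝ) : ℍ[ℝ]) := by
    intro g k
    have h1 : star (coeff k (g * sharp g)) = coeff k (g * sharp g) := by
      rw [← coeff_sharp, sharp_mul_sharp_self]
    rw [Quaternion.star_eq_self.1 h1, coeff_mul]
    congr 1
    simp only [coeff_sharp]
    exact map_sum (AddMonoidHom.mk' (fun q : ℍ[ℝ] => q.re) fun a b => Quaternion.re_add a b) _ _
  ext1 k
  have h2 := h (sharp f) k
  rw [sharp_sharp] at h2
  rw [h2, h]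
  congr 1
  rw [← Finset.Nat.sum_antidiagonal_swap]
  refine Finset.sum_congr rfl fun p _ => ?_
  simp only [coeff_sharp, Prod.fst_swap, Prod.snd_swap, star_star, Quaternion.re_mul,
    Quaternion.re_star, Quaternion.imI_star, Quaternion.imJ_star, Quaternion.imK_star]
  ring

/-- The product `f f♯` is multiplicative. -/
theorem mul_sharp_mul (f g : QSeries) :
    f * g * sharp (f * g) = f * sharp f * (g * sharp g) := by
  have h := commute_of_sharp_eq (sharp_mul_sharp_self g) (sharp f)
  rw [sharp_mul, mul_assoc, ← mul_assoc g, h.eq, ← mul_assoc]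

/-! ### Blaschke factors -/

theorem kern_mul_den (a : ℍ[ℝ]) : kern a * (1 - C (star a) * X) = 1 := by
  rw [mul_sub, mul_one, ← mul_assoc]
  ext1 k
  cases k with
  | zero => simp [kern]
  | succ k => simp [kern, coeff_mul_C, pow_succ, coeff_one, coeff_succ_mul_X]

theorem den_mul_kern (a : ℍ[ℝ]) : (1 - C (star a) * X) * kern a = 1 := by
  rw [sub_mul, one_mul, mul_assoc]
  ext1 k
  cases k with
  | zero => simp [kern]
  | succ k => simp [kern, coeff_C_mul, pow_succ', coeff_one, coeff_succ_X_mul]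

theorem commute_C_of_commute {a b : ℍ[ℝ]} (h : Commute a b) :
    Commute (C a : QSeries) (C b) := by
  rw [Commute, SemiconjBy, ← map_mul, ← map_mul, h.eq]

theorem commute_star_self (a : ℍ[ℝ]) : Commute (star a) a := by
  rw [Commute, SemiconjBy, Quaternion.star_mul_self, Quaternion.self_mul_star]

theorem commute_rho_kern (a : ℍ[ℝ]) : Commute (rho a) (kern a) := by
  have h : Commute (rho a) (1 - C (star a) * X) := by
    have h1 := commute_C_of_commute (commute_star_self a)
    have h2 : Commute (rho a) (C (star a)) :=
      ((commute_X (C (star a))).symm).sub_left h1.symm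
    exact (Commute.one_right _).sub_right (h2.mul_right (commute_X _))
  calc rho a * kern a = kern a * ((1 - C (star a) * X) * rho a) * kern a := by
        rw [← mul_assoc, kern_mul_den, one_mul]
    _ = kern a * rho a := by rw [← h.eq, mul_assoc, mul_assoc, den_mul_kern, mul_one]

theorem sharp_blaschke (a : ℍ[ℝ]) : sharp (blaschke a) = blaschke (star a) := by
  rw [blaschke, sharp_mul, sharp_rho, sharp_kern, blaschke, (commute_rho_kern _).eq]

theorem kern_ne_zero (a : ℍ[ℝ]) : kern a ≠ 0 := fun h => by
  simpa [h] using den_mul_kern a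

theorem rho_ne_zero (a : ℍ[ℝ]) : rho a ≠ 0 := fun h => by
  have := congrArg (coeff 1) h
  simp [rho] at this

theorem blaschke_ne_zero (a : ℍ[ℝ]) : blaschke a ≠ 0 :=
  mul_ne_zero (rho_ne_zero a) (kern_ne_zero a)

theorem blaschke_mul_den (a : ℍ[ℝ]) (u : QSeries) :
    blaschke a * ((1 - C (star a) * X) * u) = rho a * u := by
  rw [blaschke, mul_assoc, ← mul_assoc (kern a), kern_mul_den, one_mul]

theorem sharp_blaschke_prod (l : List ℍ[ℝ]) :
    sharp (l.map blaschke).prod = ((l.map star).reverse.map blaschke).prod := by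
  induction l with
  | nil => simp
  | cons a l ih =>
    rw [List.map_cons, List.prod_cons, sharp_mul, ih, sharp_blaschke]
    simp

/-! ### Spheres -/

theorem mem_simClass_iff {a b : ℍ[ℝ]} : b ∈ simClass a ↔ b.re = a.re ∧ ‖b‖ = ‖a‖ := by
  constructor
  · rintro ⟨h, h0, rfl⟩
    have h1 : ‖h * a * h⁻¹‖ = ‖a‖ := by
      rw [norm_mul, norm_mul, norm_inv]
      field_simp [norm_ne_zero_iff.2 h0]
    refine ⟨?_, h1⟩
    have h2 : ∀ x y : ℍ[ℝ], (x * y).re = (y * x).re := by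
      intro x y; simp only [Quaternion.re_mul]; ring
    rw [h2, ← mul_assoc, inv_mul_cancel₀ h0, one_mul]
  · rintro ⟨hre, hn⟩
    have hsq : b.re ^ 2 + b.imI ^ 2 + b.imJ ^ 2 + b.imK ^ 2
        = a.re ^ 2 + a.imI ^ 2 + a.imJ ^ 2 + a.imK ^ 2 := by
      rw [← Quaternion.normSq_def', ← Quaternion.normSq_def', Quaternion.normSq_eq_norm_mul_self,
        Quaternion.normSq_eq_norm_mul_self, hn]
    suffices ∃ h : ℍ[ℝ], h ≠ 0 ∧ h * a = b * h by
      obtain ⟨h, h0, e⟩ := this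
      exact ⟨h, h0, by rw [e, mul_assoc, mul_inv_cancel₀ h0, mul_one]⟩
    -- The element `b - ā` intertwines `a` with `b`, but vanishes when `b = ā`. In that case a
    -- nonzero pure quaternion orthogonal to the imaginary part of `a` serves.
    by_cases hb : b = star a
    · subst hb
      have hex : ∀ x y : ℝ, ∃ h : ℍ[ℝ], h.re = 0 ∧ h.imI = x ∧ h.imJ = y ∧ h.imK = 0 :=
        fun x y => ⟨⟨0, x, y, 0⟩, rfl, rfl, rfl, rfl⟩
      by_cases hc : a.imI = 0 ∧ a.imJ = 0
      · obtain ⟨h, h1, h2, h3, h4⟩ := hex 1 0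
        refine ⟨h, fun h0 => by simp [h0] at h2, ?_⟩
        ext <;> simp only [Quaternion.re_mul, Quaternion.imI_mul, Quaternion.imJ_mul,
          Quaternion.imK_mul, Quaternion.re_star, Quaternion.imI_star, Quaternion.imJ_star,
          Quaternion.imK_star, hc.1, hc.2, h1, h2, h3, h4] <;> ring
      · obtain ⟨h, h1, h2, h3, h4⟩ := hex (-a.imJ) a.imI
        refine ⟨h, fun h0 => hc ?_, ?_⟩
        · rw [h0] at h2 h3
          exact ⟨h3.symm, by simpa using h2.symm⟩
        · ext <;> simp only [Quaternion.re_mul, Quaternion.imI_mul, Quaternion.imJ_mul,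
            Quaternion.imK_mul, Quaternion.re_star, Quaternion.imI_star, Quaternion.imJ_star,
            Quaternion.imK_star, h1, h2, h3, h4] <;> ring
    · refine ⟨b - star a, sub_ne_zero.2 hb, ?_⟩
      ext <;> simp [hre] <;> [linear_combination hsq - (b.re + a.re) * hre; ring; ring; ring]

theorem self_mem_simClass (a : ℍ[ℝ]) : a ∈ simClass a := mem_simClass_iff.2 ⟨rfl, rfl⟩

theorem star_mem_simClass {a b : ℍ[ℝ]} : star b ∈ simClass a ↔ b ∈ simClass a := by
  simp [mem_simClass_iff]

theorem conj_mem_simClass {a b : ℍ[ℝ]} (hb : b ∈ simClass a) {c : ℍ[ℝ]} (hc : c ≠ 0) :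
    c⁻¹ * b * c ∈ simClass a := by
  have h : c⁻¹ * b * c ∈ simClass b := ⟨c⁻¹, inv_ne_zero hc, by rw [inv_inv]⟩
  rw [mem_simClass_iff] at *
  exact ⟨h.1.trans hb.1, h.2.trans hb.2⟩

theorem simClass_eq_of_mem {a b : ℍ[ℝ]} (h : b ∈ simClass a) : simClass b = simClass a := by
  rw [mem_simClass_iff] at h
  ext c
  rw [mem_simClass_iff, mem_simClass_iff, h.1, h.2]

theorem simClass_coe {x : ℝ} {b : ℍ[ℝ]} : b ∈ simClass (x : ℍ[ℝ]) ↔ b = x := by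
  refine ⟨?_, fun h => h ▸ self_mem_simClass _⟩
  rintro ⟨h, h0, rfl⟩
  rw [← Quaternion.coe_commutes, mul_assoc, mul_inv_cancel₀ h0, mul_one]

theorem rho_mul_rho_star {a b : ℍ[ℝ]} (h : b ∈ simClass a) :
    rho b * rho (star b) = sphPoly a := by
  obtain ⟨h1, h2⟩ := mem_simClass_iff.1 h
  have e1 : C ((2 * a.re : ℝ) : ℍ[ℝ]) = (C b + C (star b) : QSeries) := by
    rw [← map_add, Quaternion.self_add_star', h1]
  have e2 : C ((‖a‖ ^ 2 : ℝ) : ℍ[ℝ]) = (C b * C (star b) : QSeries) := by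
    rw [← map_mul, Quaternion.self_mul_star, Quaternion.normSq_eq_norm_mul_self, h2, sq]
  rw [sphPoly, e1, e2, rho, rho]
  have := (commute_X (C (star b))).eq
  rw [mul_sub, sub_mul, sub_mul, add_mul, ← this]
  noncomm_ring

theorem sharp_sphPoly (a : ℍ[ℝ]) : sharp (sphPoly a) = sphPoly a := by
  rw [← rho_mul_rho_star (self_mem_simClass a), sharp_mul, sharp_rho, sharp_rho, star_star]

theorem commute_sphPoly (a : ℍ[ℝ]) (f : QSeries) : Commute (sphPoly a) f :=
  commute_of_sharp_eq (sharp_sphPoly a) f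

theorem sphPoly_ne_zero (a : ℍ[ℝ]) : sphPoly a ≠ 0 := by
  rw [← rho_mul_rho_star (self_mem_simClass a)]
  exact mul_ne_zero (rho_ne_zero _) (rho_ne_zero _)

/-- The inverse `(1 - zā)(1 - za)` involves only the real part and the norm of `a`. -/
theorem kern_star_mul_kern {a b : ℍ[ℝ]} (h : b ∈ simClass a) :
    kern (star b) * kern b = kern (star a) * kern a := by
  have hD : ∀ c : ℍ[ℝ], (1 - C (star c) * X) * (1 - C c * X)
      = (1 - C ((2 * c.re : ℝ) : ℍ[ℝ]) * X + C ((‖c‖ ^ 2 : ℝ) : ℍ[ℝ]) * X ^ 2 : QSeries) := by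
    intro c
    have e1 : C ((2 * c.re : ℝ) : ℍ[ℝ]) = (C c + C (star c) : QSeries) := by
      rw [← map_add, Quaternion.self_add_star']
    have e2 : C ((‖c‖ ^ 2 : ℝ) : ℍ[ℝ]) = (C (star c) * C c : QSeries) := by
      rw [← map_mul, Quaternion.star_mul_self, Quaternion.normSq_eq_norm_mul_self, sq]
    have e3 : (C (star c) * X * (C c * X) : QSeries) = C (star c) * C c * X ^ 2 := by
      rw [mul_assoc, ← mul_assoc X, ← (commute_X (C c)).eq]; noncomm_ring
    rw [e1, e2, mul_sub, sub_mul, sub_mul, e3]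
    noncomm_ring
  have hI : ∀ c : ℍ[ℝ], (1 - C (star c) * X) * (1 - C c * X) * (kern (star c) * kern c) = 1 := by
    intro c
    have h1 := den_mul_kern (star c)
    rw [star_star] at h1
    rw [mul_assoc, ← mul_assoc (1 - C c * X), h1, one_mul, den_mul_kern]
  obtain ⟨h1, h2⟩ := mem_simClass_iff.1 h
  have hb := hI b
  rw [hD, h1, h2, ← hD] at hb
  refine mul_left_cancel₀ (fun h0 => ?_) (hb.trans (hI a).symm)
  have := hI a
  rw [h0, zero_mul] at this
  exact zero_ne_one this

/-- The central unit `𝒲 = ℬ_V / 𝒳_V`. -/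
noncomputable def sphKern (a : ℍ[ℝ]) : QSeries := kern (star a) * kern a

theorem sharp_sphKern (a : ℍ[ℝ]) : sharp (sphKern a) = sphKern a := by
  rw [sphKern, sharp_mul, sharp_kern, sharp_kern, star_star]

theorem blaschke_mul_blaschke_star {a b : ℍ[ℝ]} (h : b ∈ simClass a) :
    blaschke b * blaschke (star b) = sphPoly a * sphKern a := by
  have h1 : Commute (rho (star b) * kern (star b)) (kern b) := by
    have e : sharp (kern (star b) * kern b) = kern (star b) * kern b := sharp_sphKern b
    have e' : sharp (kern b * kern (star b)) = kern b * kern (star b) := by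
      rw [sharp_mul, sharp_kern, sharp_kern, star_star]
    have hk : Commute (kern (star b)) (kern b) := by
      have := kern_star_mul_kern (star_mem_simClass.2 (self_mem_simClass b))
      rw [star_star] at this
      exact this.symm
    -- Cancel `rho b`, which commutes with `kern b`, from the centrality of `rho b * rho (star b)`.
    have hr : Commute (rho (star b)) (kern b) := by
      have hs : Commute (sphPoly b) (kern b) := commute_sphPoly b _
      rw [← rho_mul_rho_star (self_mem_simClass b)] at hs
      have h2 : rho b * (rho (star b) * kern b) = rho b * (kern b * rho (star b)) := by
        rw [← mul_assoc, hs.eq, ← mul_assoc, ← mul_assoc, (commute_rho_kern b).eq]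
      exact mul_left_cancel₀ (rho_ne_zero b) h2
    exact hr.mul_left hk
  rw [blaschke, blaschke, mul_assoc, ← h1.eq, mul_assoc, ← mul_assoc, rho_mul_rho_star h,
    kern_star_mul_kern h, sphKern]

theorem sphBlaschke_eq (a : ℍ[ℝ]) : sphBlaschke a = sphPoly a * sphKern a := by
  rw [sphBlaschke, sharp_blaschke, blaschke_mul_blaschke_star (self_mem_simClass a)]

theorem sharp_sphBlaschke (a : ℍ[ℝ]) : sharp (sphBlaschke a) = sphBlaschke a :=
  sharp_mul_sharp_self _

theorem commute_sphBlaschke (a : ℍ[ℝ]) (f : QSeries) : Commute (sphBlaschke a) f :=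
  commute_of_sharp_eq (sharp_sphBlaschke a) f

theorem sphBlaschke_ne_zero (a : ℍ[ℝ]) : sphBlaschke a ≠ 0 := by
  rw [sphBlaschke, sharp_blaschke]
  exact mul_ne_zero (blaschke_ne_zero _) (blaschke_ne_zero _)

theorem blaschke_mul_star {a b : ℍ[ℝ]} (h : b ∈ simClass a) :
    blaschke b * blaschke (star b) = sphBlaschke a := by
  rw [sphBlaschke_eq, blaschke_mul_blaschke_star h]

theorem blaschke_prod_mul_sharp {a : ℍ[ℝ]} {l : List ℍ[ℝ]} (hl : ∀ b ∈ l, b ∈ simClass a) :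
    (l.map blaschke).prod * sharp (l.map blaschke).prod = sphBlaschke a ^ l.length := by
  induction l with
  | nil => simp
  | cons b l ih =>
    rw [List.map_cons, List.prod_cons, mul_sharp_mul, ih fun c hc => hl c (by simp [hc]),
      sharp_blaschke, blaschke_mul_star (hl b (by simp)), List.length_cons, pow_succ']

/-! ### The Schur class through partial sums -/

/-- The partial sum `∑_{k<n} |g_k|²`. -/
noncomputable def partialNormSq (n : ℕ) (g : QSeries) : ℝ :=
  ∑ k ∈ Finset.range n, ‖coeff k g‖ ^ 2

theorem partialNormSq_nonneg (n : ℕ) (g : QSeries) : 0 ≤ partialNormSq n g :=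
  Finset.sum_nonneg fun _ _ => by positivity

theorem partialNormSq_mono (g : QSeries) : Monotone fun n => partialNormSq n g := fun m n h =>
  Finset.sum_le_sum_of_subset_of_nonneg (Finset.range_mono h) fun _ _ _ => by positivity

theorem partialNormSq_congr {n : ℕ} {f g : QSeries} (h : ∀ k < n, coeff k f = coeff k g) :
    partialNormSq n f = partialNormSq n g :=
  Finset.sum_congr rfl fun k hk => by rw [h k (Finset.mem_range.1 hk)]

theorem hardyNormSq_eq_iSup (g : QSeries) :
    hardyNormSq g = ⨆ n, ENNReal.ofReal (partialNormSq n g) := by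
  rw [hardyNormSq, ENNReal.tsum_eq_iSup_nat]
  refine iSup_congr fun n => ?_
  rw [partialNormSq, ENNReal.ofReal_sum_of_nonneg fun _ _ => by positivity]
  refine Finset.sum_congr rfl fun k _ => ?_
  rw [ENNReal.ofReal_pow (norm_nonneg _), ofReal_norm]

/-- The polynomial `∑_{k<n} h_k z^k`. -/
noncomputable def cut (n : ℕ) (h : QSeries) : QSeries :=
  PowerSeries.mk fun k => if k < n then coeff k h else 0

theorem coeff_cut (n k : ℕ) (h : QSeries) : coeff k (cut n h) = if k < n then coeff k h else 0 := by
  simp [cut]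

theorem partialNormSq_cut_le (m n : ℕ) (h : QSeries) :
    partialNormSq m (cut n h) ≤ partialNormSq n h := by
  have e : partialNormSq n h = partialNormSq n (cut n h) :=
    partialNormSq_congr fun k hk => by simp [coeff_cut, hk]
  rw [e]
  rcases le_total m n with hmn | hmn
  · exact partialNormSq_mono _ hmn
  · refine le_of_eq (Finset.sum_subset (Finset.range_mono hmn) fun k _ hk => ?_).symm
    rw [coeff_cut, if_neg (by simpa using hk)]
    simp

theorem coeff_mul_cut {n k : ℕ} (hk : k < n) (f h : QSeries) :
    coeff k (f * cut n h) = coeff k (f * h) := by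
  rw [coeff_mul, coeff_mul]
  refine Finset.sum_congr rfl fun p hp => ?_
  rw [coeff_cut, if_pos (lt_of_le_of_lt (Finset.HasAntidiagonal.mem_antidiagonal.1 hp ▸ Nat.le_add_left _ _) hk)]

/-- Multiplication by `f` is lower triangular: the first `n` coefficients of `f h` depend only on
the first `n` of `h`. Contractivity can thus be tested on truncations, with finite sums and no
condition on `h`. -/
theorem isSchur_iff {f : QSeries} :
    IsSchur f ↔ ∀ n h, partialNormSq n (f * h) ≤ partialNormSq n h := by
  constructor
  · intro hf n h
    have h1 : hardyNormSq (cut n h) ≤ ENNReal.ofReal (partialNormSq n h) := by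
      rw [hardyNormSq_eq_iSup]
      exact iSup_le fun m => ENNReal.ofReal_le_ofReal (partialNormSq_cut_le m n h)
    have h2 := (hf (cut n h) (h1.trans_lt ENNReal.ofReal_lt_top)).trans h1
    rw [hardyNormSq_eq_iSup] at h2
    have h3 := (le_iSup (fun m => ENNReal.ofReal (partialNormSq m (f * cut n h))) n).trans h2
    rw [ENNReal.ofReal_le_ofReal_iff (partialNormSq_nonneg _ _)] at h3
    rwa [partialNormSq_congr fun k hk => coeff_mul_cut hk f h] at h3
  · intro hf h _
    rw [hardyNormSq_eq_iSup, hardyNormSq_eq_iSup]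
    exact iSup_mono fun n => ENNReal.ofReal_le_ofReal (hf n h)

theorem IsSchur.norm_coeff_le {f : QSeries} (hf : IsSchur f) (k : ℕ) : ‖coeff k f‖ ≤ 1 := by
  have h1 := isSchur_iff.1 hf (k + 1) 1
  rw [mul_one] at h1
  have h2 : partialNormSq (k + 1) 1 = 1 := by
    rw [partialNormSq, Finset.sum_eq_single 0] <;> simp +contextual [coeff_one]
  have h3 : ‖coeff k f‖ ^ 2 ≤ partialNormSq (k + 1) f :=
    Finset.single_le_sum (f := fun k => ‖coeff k f‖ ^ 2) (fun _ _ => by positivity) (by simp)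
  nlinarith [norm_nonneg (coeff k f)]

theorem IsSchur.tendsto_coeff {f : QSeries} (hf : IsSchur f) :
    Filter.Tendsto (fun k => coeff k f) Filter.atTop (nhds 0) := by
  have h : Summable fun k => ‖coeff k f‖ ^ 2 := by
    refine summable_of_sum_range_le (c := 1) (fun _ => by positivity) fun n => ?_
    have h1 := isSchur_iff.1 hf n 1
    rw [mul_one] at h1
    refine h1.trans ?_
    refine (partialNormSq_mono _ (Nat.le_succ n)).trans (le_of_eq ?_)
    show partialNormSq (n + 1) 1 = 1
    rw [partialNormSq, Finset.sum_eq_single 0] <;> simp +contextual [coeff_one]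
  have h0 := h.tendsto_atTop_zero.sqrt
  rw [tendsto_zero_iff_norm_tendsto_zero]
  simpa [Real.sqrt_sq] using h0

/-- The Toeplitz matrix of `f♯` is the flipped adjoint of that of `f`. -/
theorem IsSchur.sharp {f : QSeries} (hf : IsSchur f) : IsSchur (sharp f) := by
  have key := isSchur_iff.1 hf
  rw [isSchur_iff]
  intro n h
  rcases n with _ | n
  · simp [partialNormSq]
  set y := QSchur.sharp f * h with hy
  -- `y'` lists the coefficients of `y` up to `n` backwards, as the flip in the adjoint relation
  -- requires.
  let y' : QSeries := PowerSeries.mk fun i => if i ≤ n then coeff (n - i) y else 0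
  have hrefl : partialNormSq (n + 1) y' = partialNormSq (n + 1) y := by
    rw [partialNormSq, partialNormSq, ← Finset.sum_range_reflect]
    refine Finset.sum_congr rfl fun k hk => ?_
    have hk' : k ≤ n := Nat.lt_succ_iff.1 (Finset.mem_range.1 hk)
    simp only [y', coeff_mk, Nat.add_sub_cancel]
    rw [if_pos (Nat.sub_le _ _), Nat.sub_sub_self hk']
  have hpair : partialNormSq (n + 1) y
      = ∑ j ∈ Finset.range (n + 1), inner ℝ (coeff (n - j) (f * y')) (coeff j h) := by
    have e1 : ∀ k, ‖coeff k y‖ ^ 2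
        = ∑ j ∈ Finset.range (k + 1), inner ℝ (coeff (k - j) f * coeff k y) (coeff j h) := by
      intro k
      rw [← real_inner_self_eq_norm_sq]
      conv_lhs =>
        enter [3]
        rw [hy, coeff_mul, ← Finset.Nat.sum_antidiagonal_swap,
          Finset.Nat.sum_antidiagonal_eq_sum_range_succ_mk]
      rw [inner_sum]
      refine Finset.sum_congr rfl fun p _ => ?_
      simp only [Quaternion.inner_def, star_mul, coeff_sharp, star_star, Prod.swap]
      simp only [Quaternion.re_mul, Quaternion.imI_mul, Quaternion.imJ_mul, Quaternion.imK_mul,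
        Quaternion.re_star, Quaternion.imI_star, Quaternion.imJ_star, Quaternion.imK_star]
      ring
    have e2 : ∀ j, inner ℝ (coeff (n - j) (f * y')) (coeff j h)
        = ∑ i ∈ Finset.range (n - j + 1),
          inner ℝ (coeff (n - j - i) f * coeff (n - i) y) (coeff j h) := by
      intro j
      rw [coeff_mul, ← Finset.Nat.sum_antidiagonal_swap,
          Finset.Nat.sum_antidiagonal_eq_sum_range_succ_mk, sum_inner]
      refine Finset.sum_congr rfl fun i hi => ?_
      have hi' := Finset.mem_range.1 hi
      simp only [y', coeff_mk, Prod.swap]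
      rw [if_pos (by omega)]
    rw [partialNormSq, Finset.sum_congr rfl fun k _ => e1 k, Finset.sum_congr rfl fun j _ => e2 j,
      Finset.sum_sigma', Finset.sum_sigma']
    refine Finset.sum_bij' (fun p _ => ⟨p.2, n - p.1⟩) (fun p _ => ⟨n - p.2, p.1⟩) ?_ ?_ ?_ ?_ ?_
    · rintro ⟨k, j⟩ hp
      simp only [Finset.mem_sigma, Finset.mem_range] at hp ⊢
      omega
    · rintro ⟨k, j⟩ hp
      simp only [Finset.mem_sigma, Finset.mem_range] at hp ⊢
      omega
    · rintro ⟨k, j⟩ hp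
      simp only [Finset.mem_sigma, Finset.mem_range] at hp
      simp only [Sigma.mk.injEq, heq_eq_eq, and_true]
      omega
    · rintro ⟨k, j⟩ hp
      simp only [Finset.mem_sigma, Finset.mem_range] at hp
      simp only [Sigma.mk.injEq, heq_eq_eq, true_and]
      omega
    · rintro ⟨k, j⟩ hp
      simp only [Finset.mem_sigma, Finset.mem_range] at hp
      simp only
      rw [show n - j - (n - k) = k - j by omega, show n - (n - k) = k by omega]
  -- Bounding each inner product by half the sum of the squares gives `‖y‖² ≤ (‖y‖² + ‖h‖²) / 2`,
  -- which suffices and avoids square roots.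
  have hcs : partialNormSq (n + 1) y ≤ (partialNormSq (n + 1) y + partialNormSq (n + 1) h) / 2 := by
    calc partialNormSq (n + 1) y
        ≤ ∑ j ∈ Finset.range (n + 1), (‖coeff (n - j) (f * y')‖ ^ 2 + ‖coeff j h‖ ^ 2) / 2 := by
          rw [hpair]
          refine Finset.sum_le_sum fun j _ => ?_
          have := real_inner_le_norm (coeff (n - j) (f * y')) (coeff j h)
          nlinarith [sq_nonneg (‖coeff (n - j) (f * y')‖ - ‖coeff j h‖)]
      _ = (partialNormSq (n + 1) (f * y') + partialNormSq (n + 1) h) / 2 := by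
          rw [← Finset.sum_div, Finset.sum_add_distrib, partialNormSq, partialNormSq,
            ← Finset.sum_range_reflect (fun k => ‖coeff k (f * y')‖ ^ 2) (n + 1)]
          rfl
      _ ≤ _ := by
          rw [← hrefl]
          have := key (n + 1) y'
          linarith
  linarith

/-! ### Series converging in the unit ball -/

/-- Absolute convergence in the open unit ball. -/
def ConvergesInBall (f : QSeries) : Prop :=
  ∀ r : ℝ, 0 ≤ r → r < 1 → Summable fun k => ‖coeff k f‖ * r ^ k

theorem convergesInBall_of_bound {f : QSeries}
    (h : ∀ s : ℝ, 0 < s → s < 1 → ∃ M : ℝ, ∀ k, ‖coeff k f‖ * s ^ k ≤ M) : ConvergesInBall f := by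
  intro r hr0 hr1
  obtain ⟨s, hrs, hs1⟩ := exists_between hr1
  have hs0 : 0 < s := hr0.trans_lt hrs
  obtain ⟨M, hM⟩ := h s hs0 hs1
  have hg : Summable fun k : ℕ => M * (r / s) ^ k :=
    (summable_geometric_of_lt_one (by positivity) ((div_lt_one hs0).2 hrs)).mul_left M
  refine Summable.of_nonneg_of_le (fun k => by positivity) (fun k => ?_) hg
  calc ‖coeff k f‖ * r ^ k = ‖coeff k f‖ * s ^ k * (r / s) ^ k := by
        rw [div_pow]; field_simp
    _ ≤ _ := by
        have : 0 ≤ (r / s) ^ k := by positivity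
        exact mul_le_mul_of_nonneg_right (hM k) this

theorem ConvergesInBall.exists_bound {f : QSeries} (h : ConvergesInBall f) {s : ℝ} (hs0 : 0 < s)
    (hs1 : s < 1) : ∃ M : ℝ, 0 ≤ M ∧ ∀ k, ‖coeff k f‖ * s ^ k ≤ M :=
  ⟨∑' k, ‖coeff k f‖ * s ^ k, tsum_nonneg fun k => by positivity,
    fun k => (h s hs0.le hs1).le_tsum k fun j _ => by positivity⟩

theorem convergesInBall_of_norm_coeff_le {f : QSeries} {M : ℝ} (h : ∀ k, ‖coeff k f‖ ≤ M) :
    ConvergesInBall f :=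
  convergesInBall_of_bound fun s hs0 hs1 => ⟨M, fun k => by
    have h1 : s ^ k ≤ 1 := pow_le_one₀ hs0.le hs1.le
    have h2 : 0 ≤ s ^ k := by positivity
    nlinarith [h k, norm_nonneg (coeff k f)]⟩

theorem IsSchur.convergesInBall {f : QSeries} (hf : IsSchur f) : ConvergesInBall f :=
  convergesInBall_of_norm_coeff_le hf.norm_coeff_le

theorem convergesInBall_C (a : ℍ[ℝ]) : ConvergesInBall (C a) :=
  convergesInBall_of_norm_coeff_le (M := ‖a‖) fun k => by
    rw [coeff_C]; split_ifs <;> simp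

theorem convergesInBall_one : ConvergesInBall 1 := by
  simpa using convergesInBall_C 1

theorem convergesInBall_X : ConvergesInBall X :=
  convergesInBall_of_norm_coeff_le (M := 1) fun k => by
    rw [coeff_X]; split_ifs <;> simp

theorem ConvergesInBall.sub {f g : QSeries} (hf : ConvergesInBall f) (hg : ConvergesInBall g) :
    ConvergesInBall (f - g) := fun r hr0 hr1 =>
  Summable.of_nonneg_of_le (fun k => by positivity)
    (fun k => by
      rw [map_sub, ← add_mul]
      exact mul_le_mul_of_nonneg_right (norm_sub_le _ _) (by positivity))
    ((hf r hr0 hr1).add (hg r hr0 hr1))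

theorem convergesInBall_rho (a : ℍ[ℝ]) : ConvergesInBall (rho a) :=
  convergesInBall_X.sub (convergesInBall_C a)

theorem convergesInBall_kern {a : ℍ[ℝ]} (ha : ‖a‖ < 1) : ConvergesInBall (kern a) :=
  convergesInBall_of_norm_coeff_le (M := 1) fun k => by
    simpa [kern] using pow_le_one₀ (norm_nonneg a) ha.le

theorem ConvergesInBall.mul {f g : QSeries} (hf : ConvergesInBall f) (hg : ConvergesInBall g) :
    ConvergesInBall (f * g) := by
  intro r hr0 hr1
  have h := summable_norm_sum_mul_antidiagonal_of_summable_norm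
    ((hf r hr0 hr1).norm) ((hg r hr0 hr1).norm)
  refine Summable.of_nonneg_of_le (fun k => by positivity) (fun k => ?_) h
  rw [coeff_mul]
  refine le_trans ?_ (le_abs_self _)
  calc _ ≤ (∑ p ∈ Finset.HasAntidiagonal.antidiagonal k, ‖coeff p.1 f * coeff p.2 g‖) * r ^ k :=
        mul_le_mul_of_nonneg_right (norm_sum_le _ _) (by positivity)
    _ = _ := by
        rw [Finset.sum_mul]
        refine Finset.sum_congr rfl fun p hp => ?_
        rw [← Finset.HasAntidiagonal.mem_antidiagonal.1 hp, norm_mul, pow_add]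
        ring

theorem ConvergesInBall.pow {f : QSeries} (hf : ConvergesInBall f) (n : ℕ) :
    ConvergesInBall (f ^ n) := by
  induction n with
  | zero => simpa using convergesInBall_one
  | succ n ih => rw [pow_succ]; exact ih.mul hf

theorem ConvergesInBall.sharp {f : QSeries} (hf : ConvergesInBall f) :
    ConvergesInBall (sharp f) := fun r hr0 hr1 => by
  simpa using hf r hr0 hr1

theorem convergesInBall_blaschke {a : ℍ[ℝ]} (ha : ‖a‖ < 1) : ConvergesInBall (blaschke a) :=
  (convergesInBall_rho a).mul (convergesInBall_kern ha)

theorem convergesInBall_sphPoly (a : ℍ[ℝ]) : ConvergesInBall (sphPoly a) := by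
  rw [← rho_mul_rho_star (self_mem_simClass a)]
  exact (convergesInBall_rho _).mul (convergesInBall_rho _)

theorem convergesInBall_sphKern {a : ℍ[ℝ]} (ha : ‖a‖ < 1) : ConvergesInBall (sphKern a) :=
  (convergesInBall_kern (by simpa using ha)).mul (convergesInBall_kern ha)

theorem convergesInBall_blaschke_prod {l : List ℍ[ℝ]} (hl : ∀ a ∈ l, ‖a‖ < 1) :
    ConvergesInBall (l.map blaschke).prod := by
  induction l with
  | nil => simpa using convergesInBall_one
  | cons a l ih =>
    rw [List.map_cons, List.prod_cons]
    exact (convergesInBall_blaschke (hl a (by simp))).mul (ih fun b hb => hl b (by simp [hb]))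

/-- The Cauchy–Hadamard criterion. Absolute convergence is the form that passes readily to products
and quotients. -/
theorem inH1_iff {f : QSeries} : InH1 f ↔ ConvergesInBall f := by
  constructor
  · intro hf
    refine convergesInBall_of_bound fun s hs0 hs1 => ?_
    have h1 : (1 : ℝ≥0∞) < ENNReal.ofReal s⁻¹ := by
      rw [← ENNReal.ofReal_one, ENNReal.ofReal_lt_ofReal_iff (by positivity)]
      exact (one_lt_inv₀ hs0).2 hs1
    have h2 := Filter.eventually_lt_of_limsup_lt (lt_of_le_of_lt hf h1)
    obtain ⟨N, hN⟩ := Filter.eventually_atTop.1 (h2.and (Filter.eventually_gt_atTop 0))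
    have h3 : ∀ k ≥ N, ‖coeff k f‖ * s ^ k ≤ 1 := by
      intro k hk
      obtain ⟨h4, hk0⟩ := hN k hk
      have h5 : ‖coeff k f‖ₑ ≤ ENNReal.ofReal s⁻¹ ^ k := by
        have := ENNReal.rpow_le_rpow h4.le (Nat.cast_nonneg k)
        rwa [← ENNReal.rpow_mul, one_div_mul_cancel (by positivity), ENNReal.rpow_one,
          ENNReal.rpow_natCast] at this
      rw [← ENNReal.ofReal_pow (by positivity), ← ofReal_norm,
        ENNReal.ofReal_le_ofReal_iff (by positivity), inv_pow] at h5
      calc ‖coeff k f‖ * s ^ k ≤ (s ^ k)⁻¹ * s ^ k :=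
            mul_le_mul_of_nonneg_right h5 (by positivity)
        _ = 1 := inv_mul_cancel₀ (by positivity)
    refine ⟨1 + ∑ k ∈ Finset.range N, ‖coeff k f‖ * s ^ k, fun k => ?_⟩
    have h0 : ∀ j ∈ Finset.range N, 0 ≤ ‖coeff j f‖ * s ^ j := fun j _ => by positivity
    rcases lt_or_ge k N with hk | hk
    · have := Finset.single_le_sum h0 (Finset.mem_range.2 hk)
      linarith
    · have := Finset.sum_nonneg h0
      linarith [h3 k hk]
  · intro hf
    refine le_of_forall_gt fun b hb => ?_
    obtain ⟨c, hc1, hcb⟩ := exists_between hb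
    have hct : c ≠ ⊤ := hcb.ne_top
    obtain ⟨t, ht, rfl⟩ : ∃ t : ℝ, 1 < t ∧ c = ENNReal.ofReal t := by
      refine ⟨c.toReal, ?_, (ENNReal.ofReal_toReal hct).symm⟩
      rw [← ENNReal.toReal_one]
      exact ENNReal.toReal_strict_mono hct hc1
    have ht0 : 0 < t := one_pos.trans ht
    have h1 := (hf t⁻¹ (by positivity) (inv_lt_one_of_one_lt₀ ht)).tendsto_atTop_zero
    have h2 := (h1.eventually (gt_mem_nhds one_pos)).and (Filter.eventually_gt_atTop 0)
    refine lt_of_le_of_lt (Filter.limsup_le_of_le (by isBoundedDefault) (h2.mono ?_)) hcb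
    rintro k ⟨h3, hk⟩
    have h4 : ‖coeff k f‖ ≤ t ^ k := by
      rw [inv_pow, ← div_eq_mul_inv, div_lt_one (by positivity)] at h3
      exact h3.le
    have h5 : ‖coeff k f‖ₑ ≤ ENNReal.ofReal t ^ k := by
      rw [← ENNReal.ofReal_pow (by positivity), ← ofReal_norm]
      exact ENNReal.ofReal_le_ofReal h4
    have := ENNReal.rpow_le_rpow h5 (show 0 ≤ 1 / (k : ℝ) by positivity)
    rwa [← ENNReal.rpow_natCast, ← ENNReal.rpow_mul, mul_one_div_cancel (by positivity),
      ENNReal.rpow_one] at this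

/-! ### Left evaluation -/

theorem ConvergesInBall.summable {f : QSeries} (hf : ConvergesInBall f) {γ : ℍ[ℝ]} (hγ : ‖γ‖ < 1) :
    Summable fun k => γ ^ k * coeff k f := by
  refine Summable.of_norm ?_
  simpa [mul_comm] using hf ‖γ‖ (norm_nonneg _) hγ

theorem leftEval_sharp (f : QSeries) (γ : ℍ[ℝ]) :
    leftEval (sharp f) γ = star (rightEval f (star γ)) := by
  rw [leftEval, rightEval, tsum_star]
  simp

theorem leftEval_rho_mul {g : QSeries} (hg : ConvergesInBall g) {γ : ℍ[ℝ]} (hγ : ‖γ‖ < 1) :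
    leftEval (rho γ * g) γ = 0 := by
  have h := hg.summable hγ
  have hs : HasSum (fun k => γ ^ k * coeff k (rho γ * g)) (γ * leftEval g γ - γ * leftEval g γ) := by
    have e : (fun k => γ ^ k * coeff k (rho γ * g))
        = fun k => γ ^ k * coeff k (X * g) - γ * (γ ^ k * coeff k g) := by
      funext k
      rw [rho, sub_mul, map_sub, coeff_C_mul, mul_sub, ← mul_assoc, ← mul_assoc, ← pow_succ,
        pow_succ']
    rw [e]
    refine HasSum.sub ?_ (h.hasSum.mul_left γ)
    rw [← hasSum_nat_add_iff' 1]
    simpa [coeff_succ_X_mul, pow_succ', mul_assoc, leftEval] using h.hasSum.mul_left γ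
  rw [leftEval, hs.tsum_eq, sub_self]

theorem leftEval_C_mul {g : QSeries} {γ c : ℍ[ℝ]} (hc : c ≠ 0) :
    leftEval (C c * g) γ = c * leftEval g (c⁻¹ * γ * c) := by
  rw [leftEval, leftEval, ← tsum_mul_left]
  refine tsum_congr fun k => ?_
  have h : c * (c⁻¹ * γ * c) ^ k = γ ^ k * c := by
    have h1 : SemiconjBy c (c⁻¹ * γ * c) γ := by
      rw [SemiconjBy, ← mul_assoc, ← mul_assoc, mul_inv_cancel₀ hc, one_mul]
    exact h1.pow_right k
  rw [coeff_C_mul, ← mul_assoc, ← mul_assoc, h]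

theorem leftEval_add {f g : QSeries} (hf : ConvergesInBall f) (hg : ConvergesInBall g) {γ : ℍ[ℝ]}
    (hγ : ‖γ‖ < 1) : leftEval (f + g) γ = leftEval f γ + leftEval g γ := by
  rw [leftEval, leftEval, leftEval, ← (hf.summable hγ).tsum_add (hg.summable hγ)]
  simp [mul_add]

/-- The coefficients of the quotient of the left division of `f` by `z - γ`. -/
noncomputable def leftQuot (f : QSeries) (γ : ℍ[ℝ]) : QSeries :=
  PowerSeries.mk fun k => ∑' j, γ ^ j * coeff (k + 1 + j) f

theorem ConvergesInBall.summable_shift {f : QSeries} (hf : ConvergesInBall f) {γ : ℍ[ℝ]}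
    (hγ : ‖γ‖ < 1) (m : ℕ) : Summable fun j => γ ^ j * coeff (m + j) f := by
  obtain ⟨s, h1, h2⟩ := exists_between hγ
  have hs0 : 0 < s := (norm_nonneg _).trans_lt h1
  obtain ⟨M, hM0, hM⟩ := hf.exists_bound hs0 h2
  refine Summable.of_norm_bounded (g := fun j => M / s ^ m * (‖γ‖ / s) ^ j)
    ((summable_geometric_of_lt_one (by positivity) ((div_lt_one hs0).2 h1)).mul_left _) fun j => ?_
  rw [norm_mul, norm_pow]
  calc ‖γ‖ ^ j * ‖coeff (m + j) f‖ = ‖γ‖ ^ j * (‖coeff (m + j) f‖ * s ^ (m + j)) / s ^ (m + j) := by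
        field_simp
    _ ≤ ‖γ‖ ^ j * M / s ^ (m + j) := by gcongr; exact hM _
    _ = _ := by rw [div_pow, pow_add]; field_simp

theorem eq_leftEval_add_rho_mul {f : QSeries} (hf : ConvergesInBall f) {γ : ℍ[ℝ]}
    (hγ : ‖γ‖ < 1) : f = C (leftEval f γ) + rho γ * leftQuot f γ := by
  have h : ∀ m, ∑' j, γ ^ j * coeff (m + j) f
      = coeff m f + γ * ∑' j, γ ^ j * coeff (m + 1 + j) f := by
    intro m
    rw [(hf.summable_shift hγ m).tsum_eq_zero_add, ← tsum_mul_left]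
    simp [pow_succ', mul_assoc, add_comm, add_left_comm]
  ext1 k
  rw [rho, sub_mul, map_add, map_sub, coeff_C_mul]
  cases k with
  | zero =>
    have := h 0
    simp only [zero_add] at this
    simp [leftQuot, leftEval, this]
  | succ k =>
    have := h (k + 1)
    simp [leftQuot, coeff_succ_X_mul, this]

theorem convergesInBall_leftQuot {f : QSeries} (hf : ConvergesInBall f) {γ : ℍ[ℝ]}
    (hγ : ‖γ‖ < 1) : ConvergesInBall (leftQuot f γ) := by
  refine convergesInBall_of_bound fun s hs0 hs1 => ?_
  -- A radius above both `‖γ‖` and `s`: the first makes the tail sums geometric, the second absorbs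
  -- the weight `s ^ k`.
  obtain ⟨t, h1, ht1⟩ := exists_between (max_lt hγ hs1)
  have hγt := (le_max_left _ _).trans_lt h1
  have hst := (le_max_right _ _).trans_lt h1
  have ht0 : 0 < t := hs0.trans hst
  obtain ⟨M, hM0, hM⟩ := hf.exists_bound ht0 ht1
  have hgeo := summable_geometric_of_lt_one (show 0 ≤ ‖γ‖ / t by positivity)
    ((div_lt_one ht0).2 hγt)
  refine ⟨M / t * ∑' j : ℕ, (‖γ‖ / t) ^ j, fun k => ?_⟩
  have h2 : ‖coeff k (leftQuot f γ)‖ ≤ M / t ^ (k + 1) * ∑' j : ℕ, (‖γ‖ / t) ^ j := by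
    rw [leftQuot, coeff_mk, ← tsum_mul_left]
    refine tsum_of_norm_bounded (hgeo.mul_left _).hasSum fun j => ?_
    rw [norm_mul, norm_pow]
    calc ‖γ‖ ^ j * ‖coeff (k + 1 + j) f‖
        = ‖γ‖ ^ j * (‖coeff (k + 1 + j) f‖ * t ^ (k + 1 + j)) / t ^ (k + 1 + j) := by
          field_simp
      _ ≤ ‖γ‖ ^ j * M / t ^ (k + 1 + j) := by gcongr; exact hM _
      _ = _ := by rw [div_pow, pow_add]; field_simp
  have h3 : 0 ≤ ∑' j : ℕ, (‖γ‖ / t) ^ j := tsum_nonneg fun j => by positivity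
  calc _ ≤ M / t ^ (k + 1) * (∑' j : ℕ, (‖γ‖ / t) ^ j) * t ^ k := by gcongr
    _ = _ := by rw [pow_succ]; field_simp

theorem leftEval_mul_of_eq_zero {f g : QSeries} (hf : ConvergesInBall f) (hg : ConvergesInBall g)
    {γ : ℍ[ℝ]} (hγ : ‖γ‖ < 1) (h : leftEval f γ = 0) : leftEval (f * g) γ = 0 := by
  have e := eq_leftEval_add_rho_mul hf hγ
  rw [h, map_zero, zero_add] at e
  rw [e, mul_assoc]
  exact leftEval_rho_mul ((convergesInBall_leftQuot hf hγ).mul hg) hγ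

/-- Write `f = f(γ) + (z - γ) q`. The second term still vanishes at `γ` after multiplication by `g`,
and moving the constant `f(γ)` past powers of `γ` conjugates the point. -/
theorem leftEval_mul {f g : QSeries} (hf : ConvergesInBall f) (hg : ConvergesInBall g)
    {γ : ℍ[ℝ]} (hγ : ‖γ‖ < 1) (h : leftEval f γ ≠ 0) :
    leftEval (f * g) γ = leftEval f γ * leftEval g ((leftEval f γ)⁻¹ * γ * leftEval f γ) := by
  have e := eq_leftEval_add_rho_mul hf hγ
  have hq := (convergesInBall_leftQuot hf hγ).mul hg
  have e2 : f * g = C (leftEval f γ) * g + rho γ * (leftQuot f γ * g) := by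
    conv_lhs => rw [e]
    rw [add_mul, mul_assoc]
  rw [e2, leftEval_add ((convergesInBall_C _).mul hg) ((convergesInBall_rho _).mul hq) hγ,
    leftEval_rho_mul hq hγ, add_zero, leftEval_C_mul h]

theorem exists_eq_rho_mul {f : QSeries} (hf : ConvergesInBall f) {γ : ℍ[ℝ]} (h : IsLeftZero f γ) :
    ∃ u, ConvergesInBall u ∧ f = rho γ * u := by
  refine ⟨leftQuot f γ, convergesInBall_leftQuot hf h.1, ?_⟩
  have e := eq_leftEval_add_rho_mul hf h.1
  rwa [h.2, map_zero, zero_add] at e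

/-! ### Extraction of a Blaschke factor -/

/-- Truncated form of `|1 - āz| = |z - a|` on the unit circle: the defect telescopes to one boundary
term. -/
theorem partialNormSq_rho_mul (a : ℍ[ℝ]) (w : QSeries) (n : ℕ) :
    partialNormSq (n + 1) ((1 - C (star a) * X) * w)
      = partialNormSq (n + 1) (rho a * w) + (1 - ‖a‖ ^ 2) * ‖coeff n w‖ ^ 2 := by
  have e0 : coeff 0 ((1 - C (star a) * X) * w) = coeff 0 w := by
    rw [sub_mul, mul_assoc, map_sub, coeff_C_mul]; simp
  have e1 : ∀ k, coeff (k + 1) ((1 - C (star a) * X) * w)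
      = coeff (k + 1) w - star a * coeff k w := by
    intro k
    rw [sub_mul, mul_assoc, map_sub, coeff_C_mul, coeff_succ_X_mul, one_mul]
  have r0 : coeff 0 (rho a * w) = - (a * coeff 0 w) := by
    rw [rho, sub_mul, map_sub, coeff_C_mul]; simp
  have r1 : ∀ k, coeff (k + 1) (rho a * w) = coeff k w - a * coeff (k + 1) w := by
    intro k
    rw [rho, sub_mul, map_sub, coeff_C_mul, coeff_succ_X_mul]
  induction n with
  | zero =>
    simp only [partialNormSq, zero_add, Finset.sum_range_one, e0, r0, norm_neg, norm_mul]
    ring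
  | succ n ih =>
    rw [partialNormSq, Finset.sum_range_succ, ← partialNormSq, ih, partialNormSq, partialNormSq,
      Finset.sum_range_succ _ (n + 1), e1, r1, norm_sub_sq_real, norm_sub_sq_real, norm_mul,
      norm_mul, norm_star]
    have : inner ℝ (coeff (n + 1) w) (star a * coeff n w)
        = inner ℝ (coeff n w) (a * coeff (n + 1) w) := by
      simp only [Quaternion.inner_def, star_mul, star_star, Quaternion.re_mul, Quaternion.imI_mul,
        Quaternion.imJ_mul, Quaternion.imK_mul, Quaternion.re_star, Quaternion.imI_star,
        Quaternion.imJ_star, Quaternion.imK_star]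
      ring
    rw [this]
    ring

theorem tendsto_coeff_mul_cut {u : QSeries}
    (hu : Filter.Tendsto (fun k => coeff k u) Filter.atTop (nhds 0)) (n : ℕ) (h : QSeries) :
    Filter.Tendsto (fun k => coeff k (u * cut n h)) Filter.atTop (nhds 0) := by
  have h1 : Filter.Tendsto (fun k => ∑ j ∈ Finset.range n, coeff (k - j) u * coeff j h)
      Filter.atTop (nhds (∑ j ∈ Finset.range n, 0 * coeff j h)) :=
    tendsto_finsetSum _ fun j _ => (hu.comp (Filter.tendsto_sub_atTop_nat j)).mul_const _
  simp only [zero_mul, Finset.sum_const_zero] at h1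
  refine h1.congr' ?_
  filter_upwards [Filter.eventually_ge_atTop n] with k hk
  rw [coeff_mul, ← Finset.Nat.sum_antidiagonal_swap,
    Finset.Nat.sum_antidiagonal_eq_sum_range_succ_mk]
  rw [← Finset.sum_subset (Finset.range_mono (show n ≤ k.succ by omega))]
  · refine Finset.sum_congr rfl fun j hj => ?_
    simp only [Prod.swap, coeff_cut]
    rw [if_pos (Finset.mem_range.1 hj)]
  · intro j _ hj
    simp only [Prod.swap, coeff_cut]
    rw [if_neg (by simpa using hj), mul_zero]

theorem IsSchur.tendsto_leftQuot {f : QSeries} (hf : IsSchur f) {a : ℍ[ℝ]} (ha : ‖a‖ < 1) :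
    Filter.Tendsto (fun k => coeff k (leftQuot f a)) Filter.atTop (nhds 0) := by
  simp only [leftQuot, coeff_mk]
  have := tendsto_tsum_of_dominated_convergence
    (f := fun k j => a ^ j * coeff (k + 1 + j) f) (g := fun _ => (0 : ℍ[ℝ])) (𝓕 := Filter.atTop)
    (bound := fun j => ‖a‖ ^ j) (summable_geometric_of_lt_one (norm_nonneg a) ha) ?_ ?_
  · simpa using this
  · intro j
    have h1 : Filter.Tendsto (fun k => coeff (k + 1 + j) f) Filter.atTop (nhds 0) := by
      have := (Filter.tendsto_add_atTop_iff_nat (1 + j)).2 hf.tendsto_coeff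
      simpa [add_assoc] using this
    simpa using h1.const_mul (a ^ j)
  · refine Filter.Eventually.of_forall fun k j => ?_
    rw [norm_mul, norm_pow]
    exact mul_le_of_le_one_right (by positivity) (hf.norm_coeff_le _)

/-- With `f = (z - a) q`, take `H = (1 - zā) q`. For `h` cut to `n` coefficients, the truncated
isometry at order `M` bounds `‖H h‖²` by `‖h‖²` plus the squared modulus of the `M`-th coefficient
of `q h`. This tends to zero as `M` grows, because `h` is a polynomial and the coefficients of `q`
tend to zero. -/
theorem IsSchur.exists_eq_blaschke_mul {f : QSeries} (hf : IsSchur f) {a : ℍ[ℝ]}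
    (h : IsLeftZero f a) : ∃ H, IsSchur H ∧ f = blaschke a * H := by
  have e : f = rho a * leftQuot f a := by
    have e := eq_leftEval_add_rho_mul hf.convergesInBall h.1
    rwa [h.2, map_zero, zero_add] at e
  refine ⟨(1 - C (star a) * X) * leftQuot f a, ?_, by rw [blaschke_mul_den, ← e]⟩
  rw [isSchur_iff]
  intro n g
  have hlim : Filter.Tendsto (fun M => partialNormSq n g
      + ‖coeff M (leftQuot f a * cut n g)‖ ^ 2) Filter.atTop (nhds (partialNormSq n g)) := by
    have := ((tendsto_coeff_mul_cut (hf.tendsto_leftQuot h.1) n g).norm.pow 2).const_add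
      (partialNormSq n g)
    simpa using this
  refine ge_of_tendsto hlim ?_
  filter_upwards [Filter.eventually_ge_atTop n] with M hM
  rw [← partialNormSq_congr fun k hk => coeff_mul_cut hk _ g]
  refine (partialNormSq_mono _ (show n ≤ M + 1 by omega)).trans ?_
  show partialNormSq (M + 1) _ ≤ _
  rw [mul_assoc, partialNormSq_rho_mul, ← mul_assoc, ← e]
  have h1 := isSchur_iff.1 hf (M + 1) (cut n g)
  have h2 := partialNormSq_cut_le (M + 1) n g
  nlinarith [sq_nonneg ‖a‖, sq_nonneg ‖coeff M (leftQuot f a * cut n g)‖,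
    mul_nonneg (sq_nonneg ‖a‖) (sq_nonneg ‖coeff M (leftQuot f a * cut n g)‖)]

/-! ### Zeros in a similarity class -/

theorem norm_eq_of_mem_simClass {a b : ℍ[ℝ]} (h : b ∈ simClass a) : ‖b‖ = ‖a‖ :=
  (mem_simClass_iff.1 h).2

theorem leftEval_C (c γ : ℍ[ℝ]) : leftEval (C c) γ = c := by
  rw [leftEval, tsum_eq_single 0]
  · simp
  · intro k hk; simp [coeff_C, hk]

theorem leftEval_one (γ : ℍ[ℝ]) : leftEval 1 γ = 1 := by
  simpa using leftEval_C 1 γ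

theorem leftEval_rho (b γ : ℍ[ℝ]) : leftEval (rho b) γ = γ - b := by
  rw [leftEval, tsum_eq_sum (s := Finset.range 2)]
  · simp [Finset.sum_range_succ, rho, coeff_C, coeff_X, neg_add_eq_sub]
  · intro k hk
    have : 1 < k := by simpa using hk
    have h0 : k ≠ 0 := by omega
    have h1 : k ≠ 1 := by omega
    simp [rho, coeff_C, coeff_X, h0, h1]

theorem leftEval_kern_ne_zero {a γ : ℍ[ℝ]} (ha : ‖a‖ < 1) (hγ : ‖γ‖ < 1) :
    leftEval (kern a) γ ≠ 0 := fun h => by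
  have h1 := leftEval_mul_of_eq_zero (convergesInBall_kern ha)
    (convergesInBall_one.sub ((convergesInBall_C (star a)).mul convergesInBall_X)) hγ h
  rw [kern_mul_den, leftEval_one] at h1
  exact one_ne_zero h1

theorem leftEval_blaschke_eq_zero {a γ : ℍ[ℝ]} (ha : ‖a‖ < 1) (hγ : ‖γ‖ < 1)
    (h : leftEval (blaschke a) γ = 0) : γ = a := by
  by_contra hne
  have h1 : leftEval (rho a) γ ≠ 0 := by rwa [leftEval_rho, sub_ne_zero]
  rw [blaschke, leftEval_mul (convergesInBall_rho a) (convergesInBall_kern ha) hγ h1] at h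
  refine leftEval_kern_ne_zero ha ?_ ((mul_eq_zero.1 h).resolve_left h1)
  rwa [norm_eq_of_mem_simClass (conj_mem_simClass (self_mem_simClass γ) h1)]

theorem leftEval_blaschke_mul_self {a : ℍ[ℝ]} (ha : ‖a‖ < 1) {g : QSeries}
    (hg : ConvergesInBall g) : leftEval (blaschke a * g) a = 0 := by
  rw [blaschke, mul_assoc]
  exact leftEval_rho_mul ((convergesInBall_kern ha).mul hg) ha

/-- Constants commute with `g`, so conjugating the point only conjugates the value. -/
theorem leftEval_of_mem_simClass {g : QSeries} (hs : sharp g = g) {γ β : ℍ[ℝ]}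
    (hβ : β ∈ simClass γ) (h : leftEval g γ = 0) : leftEval g β = 0 := by
  obtain ⟨c, hc, rfl⟩ := hβ
  have h1 := leftEval_C_mul (g := g) (γ := c * γ * c⁻¹) hc
  have h2 : c⁻¹ * (c * γ * c⁻¹) * c = γ := by
    rw [mul_assoc, mul_assoc, inv_mul_cancel₀ hc, mul_one, ← mul_assoc, inv_mul_cancel₀ hc, one_mul]
  have h3 : leftEval (C c * g) (c * γ * c⁻¹) = leftEval g (c * γ * c⁻¹) * c := by
    rw [← (commute_of_sharp_eq hs (C c)).eq, leftEval, leftEval, ← tsum_mul_right]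
    simp [coeff_mul_C, mul_assoc]
  rw [h2, h, mul_zero, h3] at h1
  exact (mul_eq_zero.1 h1).resolve_right hc

theorem isRightZero_iff {f : QSeries} {γ : ℍ[ℝ]} :
    IsRightZero f γ ↔ IsLeftZero (sharp f) (star γ) := by
  rw [IsRightZero, IsLeftZero, leftEval_sharp, star_star, norm_star, star_eq_zero]

theorem isLeftZero_sharp_iff {f : QSeries} {γ : ℍ[ℝ]} :
    IsLeftZero (sharp f) γ ↔ IsRightZero f (star γ) := by
  rw [isRightZero_iff, star_star]

theorem isRightZero_sharp_iff {f : QSeries} {γ : ℍ[ℝ]} :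
    IsRightZero (sharp f) γ ↔ IsLeftZero f (star γ) := by
  rw [isRightZero_iff, sharp_sharp]

theorem isZero_sharp_iff {f : QSeries} {γ : ℍ[ℝ]} : IsZero (sharp f) γ ↔ IsZero f (star γ) := by
  rw [IsZero, IsZero, isLeftZero_sharp_iff, isRightZero_sharp_iff, or_comm]

/-- For distinct `β`, `γ` in one class, `(γ - β)⁻¹ γ (γ - β) = β̄`: the point at which `u` is tested
does not depend on `γ`. -/
theorem leftEval_rho_mul_conj {a β γ : ℍ[ℝ]} (hβ : β ∈ simClass a) (hγ : γ ∈ simClass a)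
    (hne : γ ≠ β) {u : QSeries} (hu : ConvergesInBall u) (ha : ‖a‖ < 1) :
    leftEval (rho β * u) γ = (γ - β) * leftEval u (star β) := by
  have hγ1 : ‖γ‖ < 1 := by rwa [norm_eq_of_mem_simClass hγ]
  have h1 : γ - β ≠ 0 := sub_ne_zero.2 hne
  rw [leftEval_mul (convergesInBall_rho β) hu hγ1 (by rwa [leftEval_rho]), leftEval_rho]
  congr 2
  obtain ⟨b1, b2⟩ := mem_simClass_iff.1 hβ
  obtain ⟨c1, c2⟩ := mem_simClass_iff.1 hγ
  have h2 : γ * (γ - β) = (γ - β) * star β := by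
    have hn : β * star β = γ * star γ := by
      rw [Quaternion.self_mul_star, Quaternion.self_mul_star, Quaternion.normSq_eq_norm_mul_self,
        Quaternion.normSq_eq_norm_mul_self, b2, c2]
    have ht : star β = γ + star γ - β := by
      rw [Quaternion.self_add_star', c1, ← b1, ← Quaternion.self_add_star']; abel
    rw [sub_mul, hn, ht]
    noncomm_ring
  rw [mul_assoc, h2, ← mul_assoc, inv_mul_cancel₀ h1, one_mul]

/-- After division by `z - β`, the second zero forces a zero at `β̄`, and `(z - β)(z - β̄) = 𝒳_V`.
-/
theorem exists_eq_sphPoly_mul {a β γ : ℍ[ℝ]} (hβ : β ∈ simClass a) (hγ : γ ∈ simClass a)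
    (hne : β ≠ γ) {g : QSeries} (hg : ConvergesInBall g) (ha : ‖a‖ < 1) (h1 : leftEval g β = 0)
    (h2 : leftEval g γ = 0) : ∃ v, ConvergesInBall v ∧ g = sphPoly a * v := by
  have hβ1 : ‖β‖ < 1 := by rwa [norm_eq_of_mem_simClass hβ]
  obtain ⟨u, hu, rfl⟩ := exists_eq_rho_mul hg ⟨hβ1, h1⟩
  rw [leftEval_rho_mul_conj hβ hγ hne.symm hu ha] at h2
  have h3 := (mul_eq_zero.1 h2).resolve_left (sub_ne_zero.2 hne.symm)
  obtain ⟨v, hv, rfl⟩ := exists_eq_rho_mul hu ⟨by rwa [norm_star], h3⟩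
  exact ⟨v, hv, by rw [← mul_assoc, rho_mul_rho_star hβ]⟩

theorem leftEval_sphPoly_mul {a γ : ℍ[ℝ]} (hγ : γ ∈ simClass a) (ha : ‖a‖ < 1) {v : QSeries}
    (hv : ConvergesInBall v) : leftEval (sphPoly a * v) γ = 0 := by
  rw [← rho_mul_rho_star hγ, mul_assoc]
  exact leftEval_rho_mul ((convergesInBall_rho _).mul hv)
    (by rwa [norm_eq_of_mem_simClass hγ])

theorem isSphericalZero_iff {a : ℍ[ℝ]} (ha : ‖a‖ < 1) (hre : ∀ x : ℝ, a ≠ x) {g : QSeries}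
    (hg : ConvergesInBall g) :
    IsSphericalZero g (simClass a) ↔ ∃ v, ConvergesInBall v ∧ g = sphPoly a * v := by
  constructor
  · rintro (⟨β, hβ, γ, hγ, hne, h1, h2⟩ | ⟨β, hβ, γ, hγ, hne, h1, h2⟩)
    · exact exists_eq_sphPoly_mul hβ hγ hne hg ha h1.2 h2.2
    · rw [isRightZero_iff] at h1 h2
      obtain ⟨v, hv, e⟩ := exists_eq_sphPoly_mul (star_mem_simClass.2 hβ) (star_mem_simClass.2 hγ)
        (fun h => hne (star_injective h)) hg.sharp ha h1.2 h2.2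
      refine ⟨sharp v, hv.sharp, ?_⟩
      rw [← sharp_sharp g, e, sharp_mul, sharp_sphPoly, (commute_sphPoly a _).eq]
  · rintro ⟨v, hv, rfl⟩
    refine Or.inl ⟨a, self_mem_simClass a, star a, star_mem_simClass.2 (self_mem_simClass a), ?_,
      ⟨ha, leftEval_sphPoly_mul (self_mem_simClass a) ha hv⟩,
      ⟨by rwa [norm_star], leftEval_sphPoly_mul (star_mem_simClass.2 (self_mem_simClass a)) ha hv⟩⟩
    intro h
    exact hre _ (Quaternion.star_eq_self.1 h.symm)

/-- If `f♯` does not vanish at some `γ` of the class, the product formula for `f♯ f` yields a zero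
of `f` at a conjugate of `γ`. Otherwise `f♯` vanishes on the whole class; then `𝒳_V` divides `f`,
unless the class is a real point, where left and right evaluations agree. -/
theorem exists_leftEval_eq_zero_of_mul_sharp {f : QSeries} (hf : ConvergesInBall f) {a : ℍ[ℝ]}
    (ha : ‖a‖ < 1) (h : leftEval (f * sharp f) a = 0) : ∃ β ∈ simClass a, leftEval f β = 0 := by
  by_cases hall : ∀ γ ∈ simClass a, leftEval (sharp f) γ = 0
  · by_cases hre : star a = a
    · refine ⟨a, self_mem_simClass a, ?_⟩
      have h0 := hall a (self_mem_simClass a)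
      rw [leftEval_sharp, star_eq_zero, rightEval, hre] at h0
      rw [leftEval, ← h0]
      exact tsum_congr fun k => ((commute_of_star_eq hre (coeff k f)).pow_left k).eq
    · obtain ⟨v, hv, e⟩ := exists_eq_sphPoly_mul (self_mem_simClass a)
        (star_mem_simClass.2 (self_mem_simClass a)) (Ne.symm hre) hf.sharp ha
        (hall _ (self_mem_simClass a)) (hall _ (star_mem_simClass.2 (self_mem_simClass a)))
      refine ⟨a, self_mem_simClass a, ?_⟩
      rw [← sharp_sharp f, e, sharp_mul, sharp_sphPoly, ← (commute_sphPoly a _).eq]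
      exact leftEval_sphPoly_mul (self_mem_simClass a) ha hv.sharp
  · push Not at hall
    obtain ⟨γ, hγ, hne⟩ := hall
    have h1 := leftEval_of_mem_simClass (sharp_mul_sharp_self f) hγ h
    rw [← sharp_mul_self, leftEval_mul hf.sharp hf (by rwa [norm_eq_of_mem_simClass hγ]) hne] at h1
    exact ⟨_, conj_mem_simClass hγ hne, (mul_eq_zero.1 h1).resolve_left hne⟩

theorem leftEval_mul_sharp_eq_zero {f : QSeries} (hf : ConvergesInBall f) {a β : ℍ[ℝ]}
    (hβ : β ∈ simClass a) (h : IsZero f β) : leftEval (f * sharp f) a = 0 := by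
  have hsymm : ∀ γ ∈ simClass a, a ∈ simClass γ := fun γ hγ => by
    rw [simClass_eq_of_mem hγ]; exact self_mem_simClass a
  rcases h with h | h
  · exact leftEval_of_mem_simClass (sharp_mul_sharp_self f) (hsymm _ hβ)
      (leftEval_mul_of_eq_zero hf hf.sharp h.1 h.2)
  · rw [isRightZero_iff] at h
    refine leftEval_of_mem_simClass (sharp_mul_sharp_self f) (hsymm _ (star_mem_simClass.2 hβ)) ?_
    rw [← sharp_mul_self]
    exact leftEval_mul_of_eq_zero hf.sharp hf h.1 h.2

/-- A right zero of `f` in the class makes `f f♯` vanish on it, which in turn produces a left zero.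
-/
theorem noZerosIn_iff {f : QSeries} (hf : ConvergesInBall f) {a : ℍ[ℝ]} (ha : ‖a‖ < 1) :
    NoZerosIn f (simClass a) ↔ ∀ β ∈ simClass a, leftEval f β ≠ 0 := by
  constructor
  · intro h β hβ h0
    exact h β hβ (Or.inl ⟨by rwa [norm_eq_of_mem_simClass hβ], h0⟩)
  · intro h β hβ h0
    obtain ⟨γ, hγ, h1⟩ := exists_leftEval_eq_zero_of_mul_sharp hf ha
      (leftEval_mul_sharp_eq_zero hf hβ h0)
    exact h γ hγ h1

theorem NoZerosIn.sharp {f : QSeries} {a : ℍ[ℝ]} (h : NoZerosIn f (simClass a)) :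
    NoZerosIn (sharp f) (simClass a) := fun _ hγ h0 =>
  h _ (star_mem_simClass.2 hγ) (isZero_sharp_iff.1 h0)

theorem NoZerosIn.mul {f g : QSeries} (hf : ConvergesInBall f) (hg : ConvergesInBall g) {a : ℍ[ℝ]}
    (ha : ‖a‖ < 1) (h1 : NoZerosIn f (simClass a)) (h2 : NoZerosIn g (simClass a)) :
    NoZerosIn (f * g) (simClass a) := by
  rw [noZerosIn_iff hf ha] at h1
  rw [noZerosIn_iff hg ha] at h2
  rw [noZerosIn_iff (hf.mul hg) ha]
  intro β hβ
  rw [leftEval_mul hf hg (by rwa [norm_eq_of_mem_simClass hβ]) (h1 β hβ)]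
  exact mul_ne_zero (h1 β hβ) (h2 _ (conj_mem_simClass hβ (h1 β hβ)))

theorem noZerosIn_C {a c : ℍ[ℝ]} (ha : ‖a‖ < 1) (hc : c ≠ 0) : NoZerosIn (C c) (simClass a) := by
  rw [noZerosIn_iff (convergesInBall_C c) ha]
  intro β _
  rwa [leftEval_C]

theorem noZerosIn_kern {a b : ℍ[ℝ]} (ha : ‖a‖ < 1) (hb : ‖b‖ < 1) :
    NoZerosIn (kern b) (simClass a) := by
  rw [noZerosIn_iff (convergesInBall_kern hb) ha]
  intro β hβ
  exact leftEval_kern_ne_zero hb (by rwa [norm_eq_of_mem_simClass hβ])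

theorem NoZerosIn.pow {f : QSeries} (hf : ConvergesInBall f) {a : ℍ[ℝ]} (ha : ‖a‖ < 1)
    (h : NoZerosIn f (simClass a)) (n : ℕ) : NoZerosIn (f ^ n) (simClass a) := by
  induction n with
  | zero => simpa using noZerosIn_C ha one_ne_zero
  | succ n ih => rw [pow_succ]; exact ih.mul (hf.pow n) hf ha h

theorem noZerosIn_sphKern {a : ℍ[ℝ]} (ha : ‖a‖ < 1) : NoZerosIn (sphKern a) (simClass a) :=
  (noZerosIn_kern ha (by rwa [norm_star])).mul (convergesInBall_kern (by rwa [norm_star]))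
    (convergesInBall_kern ha) ha (noZerosIn_kern ha ha)

/-- A zero of `b_β g` in `[a]` other than `β` makes `β̄` a left zero of `g`. -/
theorem leftEval_star_eq_zero {a β γ : ℍ[ℝ]} (ha : ‖a‖ < 1) (hβ : β ∈ simClass a)
    (hγ : γ ∈ simClass a) (hne : γ ≠ β) {g : QSeries} (hg : ConvergesInBall g)
    (h : leftEval (blaschke β * g) γ = 0) : leftEval g (star β) = 0 := by
  have hβ1 : ‖β‖ < 1 := by rwa [norm_eq_of_mem_simClass hβ]
  have hβ2 : ‖star β‖ < 1 := by rwa [norm_star]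
  rw [blaschke, mul_assoc,
    leftEval_rho_mul_conj hβ hγ hne ((convergesInBall_kern hβ1).mul hg) ha] at h
  have h1 := (mul_eq_zero.1 h).resolve_left (sub_ne_zero.2 hne)
  have h2 := leftEval_kern_ne_zero hβ1 hβ2
  rw [leftEval_mul (convergesInBall_kern hβ1) hg hβ2 h2] at h1
  have h3 := (mul_eq_zero.1 h1).resolve_left h2
  -- The coefficients of `kern β` are powers of `β̄`, so its value at `β̄` commutes with `β̄` and
  -- the conjugation of the point is trivial.
  have h4 : star β * leftEval (kern β) (star β) = leftEval (kern β) (star β) * star β := by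
    rw [leftEval, ← tsum_mul_left, ← tsum_mul_right]
    refine tsum_congr fun k => ?_
    simp only [kern, coeff_mk, ← pow_add, ← pow_succ, ← pow_succ']
  rwa [mul_assoc, h4, ← mul_assoc, inv_mul_cancel₀ h2, one_mul] at h3

/-! ### Products of Blaschke factors with zeros in one similarity class -/

theorem convergesInBall_prod_of_mem {a : ℍ[ℝ]} (ha : ‖a‖ < 1) {l : List ℍ[ℝ]}
    (hl : ∀ b ∈ l, b ∈ simClass a) : ConvergesInBall (l.map blaschke).prod :=
  convergesInBall_blaschke_prod fun b hb => by rwa [norm_eq_of_mem_simClass (hl b hb)]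

/-- If `γ` is not the first zero `c`, then `c̄` is a zero of the rest and can inductively be brought
to its front; `b_c b_c̄` is then exchanged for `b_γ b_γ̄`. -/
theorem exists_prod_eq_blaschke_mul {a : ℍ[ℝ]} (ha : ‖a‖ < 1) {H : QSeries}
    (hH : ConvergesInBall H) (hz : NoZerosIn H (simClass a)) {l : List ℍ[ℝ]}
    (hl : ∀ b ∈ l, b ∈ simClass a) {γ : ℍ[ℝ]} (hγ : γ ∈ simClass a)
    (h : leftEval ((l.map blaschke).prod * H) γ = 0) :
    ∃ l' : List ℍ[ℝ], (∀ b ∈ l', b ∈ simClass a) ∧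
      (l.map blaschke).prod = blaschke γ * (l'.map blaschke).prod := by
  induction l generalizing γ with
  | nil =>
    rw [List.map_nil, List.prod_nil, one_mul] at h
    exact absurd h ((noZerosIn_iff hH ha).1 hz γ hγ)
  | cons c t ih =>
    have hc : c ∈ simClass a := hl c (by simp)
    have ht : ∀ b ∈ t, b ∈ simClass a := fun b hb => hl b (by simp [hb])
    rw [List.map_cons, List.prod_cons, mul_assoc] at h
    rcases eq_or_ne γ c with rfl | hne
    · exact ⟨t, ht, rfl⟩
    · have h1 := leftEval_star_eq_zero ha hc hγ hne ((convergesInBall_prod_of_mem ha ht).mul hH) h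
      obtain ⟨t', ht', e⟩ := ih ht (star_mem_simClass.2 hc) h1
      refine ⟨star γ :: t', ?_, ?_⟩
      · intro b hb
        rcases List.mem_cons.1 hb with rfl | hb
        · exact star_mem_simClass.2 hγ
        · exact ht' b hb
      · rw [List.map_cons, List.prod_cons, e, List.map_cons, List.prod_cons, ← mul_assoc,
          ← mul_assoc, blaschke_mul_star hc, blaschke_mul_star hγ]

/-- The lists themselves may differ. The first factor of one side is a left zero of the other, hence
can be moved to its front and cancelled. -/
theorem prod_eq_prod_of_mul_eq {a : ℍ[ℝ]} (ha : ‖a‖ < 1) {H H' : QSeries}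
    (hH : ConvergesInBall H) (hH' : ConvergesInBall H') (hz : NoZerosIn H (simClass a))
    (hz' : NoZerosIn H' (simClass a)) {l l' : List ℍ[ℝ]} (hl : ∀ b ∈ l, b ∈ simClass a)
    (hl' : ∀ b ∈ l', b ∈ simClass a)
    (h : (l.map blaschke).prod * H = (l'.map blaschke).prod * H') :
    (l.map blaschke).prod = (l'.map blaschke).prod := by
  induction l generalizing l' with
  | nil =>
    cases l' with
    | nil => rfl
    | cons c t =>
      have hc : c ∈ simClass a := hl' c (by simp)
      have ht := convergesInBall_prod_of_mem ha fun b hb => hl' b (List.mem_cons_of_mem c hb)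
      rw [List.map_nil, List.prod_nil, one_mul, List.map_cons, List.prod_cons, mul_assoc] at h
      refine absurd ?_ ((noZerosIn_iff hH ha).1 hz c hc)
      rw [h]
      exact leftEval_blaschke_mul_self (by rwa [norm_eq_of_mem_simClass hc]) (ht.mul hH')
  | cons c t ih =>
    have hc : c ∈ simClass a := hl c (by simp)
    have ht : ∀ b ∈ t, b ∈ simClass a := fun b hb => hl b (by simp [hb])
    rw [List.map_cons, List.prod_cons, mul_assoc] at h
    have h0 : leftEval ((l'.map blaschke).prod * H') c = 0 := by
      rw [← h]
      exact leftEval_blaschke_mul_self (by rwa [norm_eq_of_mem_simClass hc])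
        ((convergesInBall_prod_of_mem ha ht).mul hH)
    obtain ⟨t', ht', e⟩ := exists_prod_eq_blaschke_mul ha hH' hz' hl' hc h0
    rw [e, mul_assoc] at h
    rw [e, List.map_cons, List.prod_cons, ih ht ht' (mul_left_cancel₀ (blaschke_ne_zero c) h)]

theorem leftEval_prod_eq_zero {l : List ℍ[ℝ]} (hl : ∀ b ∈ l, ‖b‖ < 1) {γ : ℍ[ℝ]} (hγ : ‖γ‖ < 1)
    (h : leftEval (l.map blaschke).prod γ = 0) : ∃ b ∈ l, b ∈ simClass γ := by
  induction l generalizing γ with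
  | nil => exact absurd (leftEval_one γ) (by rw [List.map_nil, List.prod_nil] at h; simp [h])
  | cons c t ih =>
    have hc := hl c (by simp)
    have ht : ∀ b ∈ t, ‖b‖ < 1 := fun b hb => hl b (by simp [hb])
    rw [List.map_cons, List.prod_cons] at h
    by_cases h0 : leftEval (blaschke c) γ = 0
    · refine ⟨c, by simp, ?_⟩
      rw [leftEval_blaschke_eq_zero hc hγ h0]
      exact self_mem_simClass c
    · rw [leftEval_mul (convergesInBall_blaschke hc) (convergesInBall_blaschke_prod ht) hγ h0] at h
      have hconj := conj_mem_simClass (self_mem_simClass γ) h0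
      obtain ⟨b, hb, hbγ⟩ := ih ht (by rwa [norm_eq_of_mem_simClass hconj])
        ((mul_eq_zero.1 h).resolve_left h0)
      exact ⟨b, by simp [hb], by rwa [simClass_eq_of_mem hconj] at hbγ⟩

theorem zerosIn_prod {a : ℍ[ℝ]} (ha : ‖a‖ < 1) {l : List ℍ[ℝ]} (hl : ∀ b ∈ l, b ∈ simClass a) :
    ZerosIn (l.map blaschke).prod (simClass a) := by
  have key : ∀ l : List ℍ[ℝ], (∀ b ∈ l, b ∈ simClass a) → ∀ γ : ℍ[ℝ],
      IsLeftZero (l.map blaschke).prod γ → γ ∈ simClass a := by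
    intro l hl γ h
    obtain ⟨b, hb, hbγ⟩ := leftEval_prod_eq_zero
      (fun b hb => by rwa [norm_eq_of_mem_simClass (hl b hb)]) h.1 h.2
    rw [← simClass_eq_of_mem (hl b hb), simClass_eq_of_mem hbγ]
    exact self_mem_simClass γ
  rintro γ (h | h)
  · exact key l hl γ h
  · rw [isRightZero_iff, sharp_blaschke_prod] at h
    refine star_mem_simClass.1 (key _ ?_ _ h)
    intro b hb
    obtain ⟨c, hc, rfl⟩ := List.mem_map.1 (List.mem_reverse.1 hb)
    exact star_mem_simClass.2 (hl c hc)

theorem leftEval_prod_mul_sharp {l : List ℍ[ℝ]} (hl : ∀ b ∈ l, ‖b‖ < 1) {c : ℍ[ℝ]} (hc : c ∈ l) :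
    leftEval ((l.map blaschke).prod * sharp (l.map blaschke).prod) c = 0 := by
  induction l with
  | nil => simp at hc
  | cons d t ih =>
    have hd := convergesInBall_blaschke (hl d (by simp))
    have ht : ∀ b ∈ t, ‖b‖ < 1 := fun b hb => hl b (by simp [hb])
    have htc := convergesInBall_blaschke_prod ht
    rw [List.map_cons, List.prod_cons, mul_sharp_mul]
    rcases List.mem_cons.1 hc with rfl | hc'
    · rw [mul_assoc]
      exact leftEval_blaschke_mul_self (hl c (by simp)) (hd.sharp.mul (htc.mul htc.sharp))
    · rw [(commute_of_sharp_eq (sharp_mul_sharp_self (blaschke d)) _).eq]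
      exact leftEval_mul_of_eq_zero (htc.mul htc.sharp) (hd.mul hd.sharp) (hl c hc) (ih ht hc')

/-- Not every `b` in the list is itself a zero of the product, but its class contains one, since the
product times its `♯` vanishes at `b`. -/
theorem mem_simClass_of_zerosIn {a φ : ℍ[ℝ]} {l : List ℍ[ℝ]}
    (hl : ∀ b ∈ l, ‖b‖ < 1) (h : ZerosIn ((l.map blaschke).prod * C φ) (simClass a)) :
    ∀ b ∈ l, b ∈ simClass a := by
  intro b hb
  have hc := convergesInBall_blaschke_prod hl
  obtain ⟨γ, hγ, h0⟩ := exists_leftEval_eq_zero_of_mul_sharp hc (hl b hb)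
    (leftEval_prod_mul_sharp hl hb)
  have hγ1 : ‖γ‖ < 1 := by rw [norm_eq_of_mem_simClass hγ]; exact hl b hb
  have h1 := h γ (Or.inl ⟨hγ1, leftEval_mul_of_eq_zero hc (convergesInBall_C φ) hγ1 h0⟩)
  rw [← simClass_eq_of_mem h1, simClass_eq_of_mem hγ]
  exact self_mem_simClass b

/-! ### Existence of the Blaschke divisor -/

theorem coeff_mul_of_coeff_lt {b g : QSeries} {m : ℕ} (h : ∀ j < m, coeff j g = 0) :
    coeff m (b * g) = coeff 0 b * coeff m g := by
  rw [coeff_mul, Finset.sum_eq_single (0, m)]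
  · rintro ⟨i, j⟩ hp hne
    have e := Finset.HasAntidiagonal.mem_antidiagonal.1 hp
    simp only at e
    have : j < m := by
      rcases Nat.eq_zero_or_pos i with rfl | hi
      · exact absurd (by simp [← e]) hne
      · omega
    simp [h j this]
  · intro hp
    exact absurd (Finset.HasAntidiagonal.mem_antidiagonal.2 (by simp)) hp

theorem coeff_eq_zero_of_coeff_mul {b g : QSeries} (hb : coeff 0 b ≠ 0) {k : ℕ}
    (h : ∀ j < k, coeff j (b * g) = 0) : ∀ j < k, coeff j g = 0 := by
  intro j
  induction j using Nat.strong_induction_on with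
  | _ j ih =>
    intro hj
    have h1 := h j hj
    rw [coeff_mul_of_coeff_lt fun i hi => ih i hi (hi.trans hj)] at h1
    exact (mul_eq_zero.1 h1).resolve_left hb

theorem coeff_zero_blaschke (a : ℍ[ℝ]) : coeff 0 (blaschke a) = -a := by
  rw [blaschke, coeff_mul]
  simp [rho, kern]

/-- Below the first nonzero coefficient, each factor contributes only its constant term, of modulus
`‖a‖`; coefficients of `H` are at most `1` in modulus. -/
theorem norm_coeff_prod_mul_le {a : ℍ[ℝ]} (ha0 : a ≠ 0) {H : QSeries} (hH : IsSchur H)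
    {l : List ℍ[ℝ]} (hl : ∀ b ∈ l, b ∈ simClass a) {k : ℕ}
    (h : ∀ j < k, coeff j ((l.map blaschke).prod * H) = 0) :
    ‖coeff k ((l.map blaschke).prod * H)‖ ≤ ‖a‖ ^ l.length := by
  induction l with
  | nil => simpa using hH.norm_coeff_le k
  | cons c t ih =>
    have hc := norm_eq_of_mem_simClass (hl c (by simp))
    rw [List.map_cons, List.prod_cons, mul_assoc] at h ⊢
    have h0 : coeff 0 (blaschke c) ≠ 0 := by
      rw [coeff_zero_blaschke, neg_ne_zero, ← norm_ne_zero_iff, hc]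
      exact norm_ne_zero_iff.2 ha0
    have h1 := coeff_eq_zero_of_coeff_mul h0 h
    rw [coeff_mul_of_coeff_lt h1, coeff_zero_blaschke, norm_mul, norm_neg, hc, List.length_cons,
      pow_succ']
    exact mul_le_mul_of_nonneg_left (ih (fun b hb => hl b (by simp [hb])) h1) (norm_nonneg a)

theorem exists_length_le {f : QSeries} (hf0 : f ≠ 0) {a : ℍ[ℝ]} (ha : ‖a‖ < 1) :
    ∃ N : ℕ, ∀ l : List ℍ[ℝ], (∀ b ∈ l, b ∈ simClass a) → ∀ H, IsSchur H →
      f = (l.map blaschke).prod * H → l.length ≤ N := by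
  classical
  have hex : ∃ k, coeff k f ≠ 0 := by
    by_contra! h
    exact hf0 (PowerSeries.ext fun k => by simpa using h k)
  have hlt : ∀ j < Nat.find hex, coeff j f = 0 := fun j hj => by
    simpa using Nat.find_min hex hj
  have hk := Nat.find_spec hex
  generalize Nat.find hex = k at hlt hk
  -- For `a = 0` the constant terms vanish and the product is a power of `z`, so the order of `f` is
  -- the bound.
  rcases eq_or_ne a 0 with rfl | ha0
  · refine ⟨k, fun l hl H _ e => ?_⟩
    have hl0 : ∀ b ∈ l, b = 0 := fun b hb =>
      norm_eq_zero.1 ((norm_eq_of_mem_simClass (hl b hb)).trans norm_zero)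
    have hb0 : blaschke 0 = X := by
      have h1 := kern_mul_den 0
      simp only [star_zero, map_zero, zero_mul, sub_zero, mul_one] at h1
      rw [blaschke, h1, rho, map_zero, sub_zero, mul_one]
    rw [List.eq_replicate_iff.2 ⟨rfl, hl0⟩, List.map_replicate, List.prod_replicate, hb0] at e
    by_contra! hlen
    refine hk ?_
    rw [e, ((commute_X H).pow_right l.length).eq.symm, coeff_mul_X_pow', if_neg (by omega)]
  · obtain ⟨N, hN⟩ := exists_pow_lt_of_lt_one (norm_pos_iff.2 hk) ha
    refine ⟨N, fun l hl H hH e => ?_⟩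
    by_contra! hlen
    rw [e] at hlt hN
    have h1 := norm_coeff_prod_mul_le ha0 hH hl hlt
    have h2 := pow_le_pow_of_le_one (norm_nonneg a) ha.le hlen.le
    linarith

/-- A longest list works: a zero of its cofactor in the class would lengthen it. -/
theorem exists_eq_prod_mul {f : QSeries} (hf : IsSchur f) (hf0 : f ≠ 0) {a : ℍ[ℝ]} (ha : ‖a‖ < 1) :
    ∃ l : List ℍ[ℝ], (∀ b ∈ l, b ∈ simClass a) ∧ ∃ H, IsSchur H ∧ NoZerosIn H (simClass a) ∧
      f = (l.map blaschke).prod * H := by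
  classical
  obtain ⟨N, hN⟩ := exists_length_le hf0 ha
  let P : ℕ → Prop := fun n => ∃ l : List ℍ[ℝ], (∀ b ∈ l, b ∈ simClass a) ∧ l.length = n ∧
    ∃ H, IsSchur H ∧ f = (l.map blaschke).prod * H
  have hP0 : P 0 := ⟨[], by simp, rfl, f, hf, by simp⟩
  obtain ⟨l, hl, hlen, H, hH, e⟩ : P (Nat.findGreatest P N) :=
    Nat.findGreatest_spec (Nat.zero_le N) hP0
  refine ⟨l, hl, H, hH, ?_, e⟩
  rw [noZerosIn_iff hH.convergesInBall ha]
  intro β hβ h0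
  obtain ⟨H', hH', e'⟩ := hH.exists_eq_blaschke_mul
    ⟨by rwa [norm_eq_of_mem_simClass hβ], h0⟩
  have hl' : ∀ b ∈ l ++ [β], b ∈ simClass a := by
    intro b hb
    rcases List.mem_append.1 hb with hb | hb
    · exact hl b hb
    · rw [List.mem_singleton.1 hb]; exact hβ
  have e2 : f = ((l ++ [β]).map blaschke).prod * H' := by
    rw [e, e']; simp [mul_assoc]
  have h1 : P (l ++ [β]).length := ⟨_, hl', rfl, H', hH', e2⟩
  have h2 := Nat.le_findGreatest (hN _ hl' H' hH' e2) h1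
  rw [List.length_append, hlen, List.length_singleton] at h2
  omega

/-! ### Spherical chains -/

/-- Free reduction: a new factor either prolongs the chain or meets its conjugate at the head, and
the pair becomes the central `ℬ_V`. -/
theorem exists_chain {a : ℍ[ℝ]} {l : List ℍ[ℝ]} (hl : ∀ b ∈ l, b ∈ simClass a) :
    ∃ (κ : ℕ) (c : List ℍ[ℝ]), IsSphericalChain (simClass a) c ∧ l.length = 2 * κ + c.length ∧
      (l.map blaschke).prod = sphBlaschke a ^ κ * (c.map blaschke).prod := by
  induction l with
  | nil => exact ⟨0, [], ⟨by simp, by simp⟩, by simp, by simp⟩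
  | cons b t ih =>
    have hb := hl b (by simp)
    obtain ⟨κ, c, hc, hlen, e⟩ := ih fun d hd => hl d (by simp [hd])
    have hcomm := ((commute_sphBlaschke a (blaschke b)).pow_left κ).eq
    have hgood : (∀ d ∈ c.head?, d ≠ star b) → ∃ (κ : ℕ) (c : List ℍ[ℝ]),
        IsSphericalChain (simClass a) c ∧ (b :: t).length = 2 * κ + c.length ∧
        ((b :: t).map blaschke).prod = sphBlaschke a ^ κ * (c.map blaschke).prod := by
      intro h
      refine ⟨κ, b :: c, ⟨?_, List.isChain_cons.2 ⟨h, hc.2⟩⟩, by simp [hlen]; omega, ?_⟩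
      · intro d hd
        rcases List.mem_cons.1 hd with rfl | hd
        · exact hb
        · exact hc.1 d hd
      · rw [List.map_cons, List.prod_cons, e, List.map_cons, List.prod_cons, ← mul_assoc, ← hcomm,
          mul_assoc]
    rcases c with _ | ⟨d, c⟩
    · exact hgood (by simp)
    · by_cases hd : d = star b
      · refine ⟨κ + 1, c, ⟨fun x hx => hc.1 x (by simp [hx]), hc.2.of_cons⟩, ?_, ?_⟩
        · simp only [List.length_cons] at hlen ⊢; omega
        · rw [List.map_cons, List.prod_cons, e, List.map_cons, List.prod_cons, hd, ← mul_assoc,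
            ← hcomm, pow_succ, ← blaschke_mul_star hb]
          simp only [mul_assoc]
      · exact hgood (by simpa using hd)

/-- A zero other than the head `b` would make `b̄` a zero of the tail. The only one there is the
next entry, which the chain condition keeps different from `b̄`; after the last entry, `H` has no
zeros. -/
theorem eq_head_of_leftEval_eq_zero {a : ℍ[ℝ]} (ha : ‖a‖ < 1) {H : QSeries}
    (hH : ConvergesInBall H) (hz : NoZerosIn H (simClass a)) {b : ℍ[ℝ]} {t : List ℍ[ℝ]}
    (hc : IsSphericalChain (simClass a) (b :: t)) {γ : ℍ[ℝ]} (hγ : γ ∈ simClass a)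
    (h : leftEval (((b :: t).map blaschke).prod * H) γ = 0) : γ = b := by
  induction t generalizing b γ with
  | nil =>
    by_contra hne
    have hb := hc.1 b (by simp)
    rw [List.map_singleton, List.prod_singleton] at h
    exact (noZerosIn_iff hH ha).1 hz _ (star_mem_simClass.2 hb)
      (leftEval_star_eq_zero ha hb hγ hne hH h)
  | cons d t ih =>
    by_contra hne
    have hb := hc.1 b (by simp)
    have ht : ∀ x ∈ d :: t, x ∈ simClass a := fun x hx => hc.1 x (List.mem_cons_of_mem b hx)
    rw [List.map_cons, List.prod_cons, mul_assoc] at h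
    have h1 := leftEval_star_eq_zero ha hb hγ hne ((convergesInBall_prod_of_mem ha ht).mul hH) h
    have h2 := ih ⟨ht, hc.2.of_cons⟩ (star_mem_simClass.2 hb) h1
    exact (List.isChain_cons_cons.1 hc.2).1 h2.symm

theorem chain_eq_of_mul_eq {a : ℍ[ℝ]} (ha : ‖a‖ < 1) {H H' : QSeries}
    (hH : ConvergesInBall H) (hH' : ConvergesInBall H') (hz : NoZerosIn H (simClass a))
    (hz' : NoZerosIn H' (simClass a)) {c c' : List ℍ[ℝ]} (hc : IsSphericalChain (simClass a) c)
    (hc' : IsSphericalChain (simClass a) c')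
    (h : (c.map blaschke).prod * H = (c'.map blaschke).prod * H') : c = c' := by
  have hzero : ∀ (G : QSeries), ConvergesInBall G → ∀ (b : ℍ[ℝ]) (t : List ℍ[ℝ]),
      IsSphericalChain (simClass a) (b :: t) →
      leftEval (((b :: t).map blaschke).prod * G) b = 0 := by
    intro G hG b t hbt
    rw [List.map_cons, List.prod_cons, mul_assoc]
    exact leftEval_blaschke_mul_self (by rwa [norm_eq_of_mem_simClass (hbt.1 b (by simp))])
      ((convergesInBall_prod_of_mem ha fun x hx => hbt.1 x (List.mem_cons_of_mem b hx)).mul hG)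
  induction c generalizing c' with
  | nil =>
    rcases c' with _ | ⟨d, t'⟩
    · rfl
    · rw [List.map_nil, List.prod_nil, one_mul] at h
      have := hzero H' hH' d t' hc'
      rw [← h] at this
      exact absurd this ((noZerosIn_iff hH ha).1 hz d (hc'.1 d (by simp)))
  | cons b t ih =>
    have h0 := hzero H hH b t hc
    rw [h] at h0
    rcases c' with _ | ⟨d, t'⟩
    · rw [List.map_nil, List.prod_nil, one_mul] at h0
      exact absurd h0 ((noZerosIn_iff hH' ha).1 hz' b (hc.1 b (by simp)))
    · obtain rfl := eq_head_of_leftEval_eq_zero ha hH' hz' hc' (hc.1 b (by simp)) h0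
      rw [List.map_cons, List.prod_cons, List.map_cons, List.prod_cons, mul_assoc, mul_assoc] at h
      rw [ih ⟨fun x hx => hc.1 x (List.mem_cons_of_mem b hx), hc.2.of_cons⟩
        ⟨fun x hx => hc'.1 x (List.mem_cons_of_mem b hx), hc'.2.of_cons⟩
        (mul_left_cancel₀ (blaschke_ne_zero b) h)]

/-! ### Multiplicities -/

/-- A spherical zero would make both `a` and `ā` equal to the head of the chain. -/
theorem not_isSphericalZero_chain {a : ℍ[ℝ]} (ha : ‖a‖ < 1) (hre : ∀ x : ℝ, a ≠ x) {H : QSeries}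
    (hH : ConvergesInBall H) (hz : NoZerosIn H (simClass a)) {c : List ℍ[ℝ]}
    (hc : IsSphericalChain (simClass a) c) :
    ¬ IsSphericalZero ((c.map blaschke).prod * H) (simClass a) := by
  rw [isSphericalZero_iff ha hre ((convergesInBall_prod_of_mem ha hc.1).mul hH)]
  rintro ⟨v, hv, e⟩
  have h0 : ∀ γ ∈ simClass a, leftEval ((c.map blaschke).prod * H) γ = 0 := fun γ hγ => by
    rw [e]; exact leftEval_sphPoly_mul hγ ha hv
  have hs := star_mem_simClass.2 (self_mem_simClass a)
  rcases c with _ | ⟨b, t⟩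
  · rw [List.map_nil, List.prod_nil, one_mul] at h0
    exact (noZerosIn_iff hH ha).1 hz a (self_mem_simClass a) (h0 a (self_mem_simClass a))
  · have h1 := eq_head_of_leftEval_eq_zero ha hH hz hc (self_mem_simClass a)
      (h0 a (self_mem_simClass a))
    have h2 := eq_head_of_leftEval_eq_zero ha hH hz hc hs (h0 _ hs)
    exact hre _ (Quaternion.star_eq_self.1 (h2.trans h1.symm))

theorem HasSphMult.unique {f : QSeries} {a : ℍ[ℝ]} (ha : ‖a‖ < 1) (hre : ∀ x : ℝ, a ≠ x) {m n : ℕ}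
    (hm : HasSphMult f a m) (hn : HasSphMult f a n) : m = n := by
  have key : ∀ m n : ℕ, HasSphMult f a m → HasSphMult f a n → ¬ m < n := by
    rintro m n ⟨g, hg, hgs, e⟩ ⟨g', hg', -, e'⟩ hlt
    rw [inH1_iff] at hg hg'
    obtain ⟨d, rfl⟩ := Nat.exists_eq_add_of_lt hlt
    rw [e, add_assoc, pow_add, mul_assoc] at e'
    refine hgs ((isSphericalZero_iff ha hre hg).2
      ⟨sphPoly a ^ d * g', ((convergesInBall_sphPoly a).pow d).mul hg', ?_⟩)
    rw [mul_left_cancel₀ (pow_ne_zero m (sphPoly_ne_zero a)) e', pow_succ', mul_assoc]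
  exact le_antisymm (not_lt.1 (key n m hn hm)) (not_lt.1 (key m n hm hn))

/-- `ℬ_V` and `𝒳_V` differ by the central zero-free factor `sphKern a`, which is absorbed into `H`.
-/
theorem hasSphMult_of_eq_sphBlaschke_pow_mul {a : ℍ[ℝ]} (ha : ‖a‖ < 1) (hre : ∀ x : ℝ, a ≠ x)
    {H : QSeries} (hH : ConvergesInBall H) (hz : NoZerosIn H (simClass a)) {c : List ℍ[ℝ]}
    (hc : IsSphericalChain (simClass a) c) (n : ℕ) :
    HasSphMult (sphBlaschke a ^ n * (c.map blaschke).prod * H) a n := by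
  have hW := (convergesInBall_sphKern ha).pow n
  have hWH := hW.mul hH
  refine ⟨(c.map blaschke).prod * (sphKern a ^ n * H),
    inH1_iff.2 ((convergesInBall_prod_of_mem ha hc.1).mul hWH),
    not_isSphericalZero_chain ha hre hWH
      (((noZerosIn_sphKern ha).pow (convergesInBall_sphKern ha) ha n).mul hW hH ha hz) hc, ?_⟩
  have hcomm := ((commute_of_sharp_eq (sharp_sphKern a) (c.map blaschke).prod).pow_left n).eq
  rw [sphBlaschke_eq, (commute_sphPoly a _).mul_pow, ← mul_assoc (List.prod _), ← hcomm]
  simp only [mul_assoc]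

theorem HasSphMult.sharp {f : QSeries} {a : ℍ[ℝ]} {n : ℕ} (h : HasSphMult f a n) :
    HasSphMult (sharp f) a n := by
  obtain ⟨g, hg, hgs, rfl⟩ := h
  refine ⟨QSchur.sharp g, inH1_iff.2 (inH1_iff.1 hg).sharp, fun hs => hgs ?_, ?_⟩
  · rcases hs with ⟨β, hβ, γ, hγ, hne, h1, h2⟩ | ⟨β, hβ, γ, hγ, hne, h1, h2⟩
    · exact Or.inr ⟨star β, star_mem_simClass.2 hβ, star γ, star_mem_simClass.2 hγ,
        fun h => hne (star_injective h), isLeftZero_sharp_iff.1 h1, isLeftZero_sharp_iff.1 h2⟩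
    · exact Or.inl ⟨star β, star_mem_simClass.2 hβ, star γ, star_mem_simClass.2 hγ,
        fun h => hne (star_injective h), isRightZero_sharp_iff.1 h1, isRightZero_sharp_iff.1 h2⟩
  · rw [sharp_mul, sharp_pow, sharp_sphPoly, ((commute_sphPoly a _).pow_left n).eq]

theorem HasRealMult.sharp {f : QSeries} {x : ℝ} {n : ℕ} (h : HasRealMult f x n) :
    HasRealMult (sharp f) x n := by
  obtain ⟨g, hg, hgz, rfl⟩ := h
  have hr : QSchur.sharp (rho (x : ℍ[ℝ])) = rho x := by rw [sharp_rho, Quaternion.star_coe]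
  refine ⟨QSchur.sharp g, inH1_iff.2 (inH1_iff.1 hg).sharp, fun hs => hgz ?_, ?_⟩
  · simpa using isZero_sharp_iff.1 hs
  · rw [sharp_mul, sharp_pow, hr, ((commute_of_sharp_eq hr _).pow_left n).eq]

theorem HasRealMult.unique {f : QSeries} {x : ℝ} (hx : ‖(x : ℍ[ℝ])‖ < 1) {m n : ℕ}
    (hm : HasRealMult f x m) (hn : HasRealMult f x n) : m = n := by
  have key : ∀ m n : ℕ, HasRealMult f x m → HasRealMult f x n → ¬ m < n := by
    rintro m n ⟨g, hg, hgz, e⟩ ⟨g', hg', -, e'⟩ hlt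
    rw [inH1_iff] at hg'
    obtain ⟨d, rfl⟩ := Nat.exists_eq_add_of_lt hlt
    rw [e, add_assoc, pow_add, mul_assoc] at e'
    refine hgz (Or.inl ⟨hx, ?_⟩)
    rw [mul_left_cancel₀ (pow_ne_zero m (rho_ne_zero _)) e', pow_succ', mul_assoc]
    exact leftEval_rho_mul (((convergesInBall_rho _).pow d).mul hg') hx
  exact le_antisymm (not_lt.1 (key n m hn hm)) (not_lt.1 (key m n hm hn))

theorem hasRealMult_blaschke_pow_mul {x : ℝ} (hx : ‖(x : ℍ[ℝ])‖ < 1) {H : QSeries}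
    (hH : ConvergesInBall H) (hz : NoZerosIn H (simClass (x : ℍ[ℝ]))) (n : ℕ) :
    HasRealMult (blaschke (x : ℍ[ℝ]) ^ n * H) x n := by
  have hk := convergesInBall_kern hx
  refine ⟨kern x ^ n * H, inH1_iff.2 ((hk.pow n).mul hH),
    ((noZerosIn_kern hx hx).pow hk hx n).mul (hk.pow n) hH hx hz _ (self_mem_simClass _), ?_⟩
  rw [blaschke, (commute_rho_kern _).mul_pow, mul_assoc]

/-! ### Divisors -/

theorem isBlaschkeProd_sharp {B : QSeries} (h : IsBlaschkeProd B) : IsBlaschkeProd (sharp B) := by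
  obtain ⟨l, hl, rfl⟩ := h
  refine ⟨(l.map star).reverse, fun b hb => ?_, sharp_blaschke_prod l⟩
  obtain ⟨c, hc, rfl⟩ := List.mem_map.1 (List.mem_reverse.1 hb)
  rw [norm_star]
  exact hl c hc

/-- The involution moves the unimodular constant to the left; rotating the zeros brings it back to
the right. -/
theorem C_mul_blaschke {φ : ℍ[ℝ]} (hφ : ‖φ‖ = 1) (a : ℍ[ℝ]) :
    C φ * blaschke a = blaschke (φ * a * star φ) * C φ := by
  have h1 : star φ * φ = 1 := by
    rw [Quaternion.star_mul_self, Quaternion.normSq_eq_norm_mul_self, hφ]; simp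
  have hr : C φ * rho a = rho (φ * a * star φ) * C φ := by
    rw [rho, rho, mul_sub, sub_mul, ← map_mul, ← map_mul, mul_assoc (φ * a), h1, mul_one,
      (commute_X (C φ)).eq]
  have hd : (1 - C (star (φ * a * star φ)) * X) * C φ = C φ * (1 - C (star a) * X) := by
    rw [sub_mul, mul_sub, one_mul, mul_one, mul_assoc, ← (commute_X (C φ)).eq, ← mul_assoc,
      ← mul_assoc, ← map_mul, ← map_mul, star_mul, star_mul, star_star, ← mul_assoc, mul_assoc _ _ φ,
      h1, mul_one]
  generalize φ * a * star φ = b at hr hd ⊢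
  have hk : C φ * kern a = kern b * C φ := by
    calc C φ * kern a
        = kern b * ((1 - C (star b) * X) * C φ) * kern a := by
          rw [← mul_assoc, kern_mul_den, one_mul]
      _ = _ := by rw [hd, mul_assoc, mul_assoc, den_mul_kern, mul_one]
  rw [blaschke, blaschke, ← mul_assoc, hr, mul_assoc, hk, ← mul_assoc]

theorem C_mul_prod {φ : ℍ[ℝ]} (hφ : ‖φ‖ = 1) (l : List ℍ[ℝ]) :
    C φ * (l.map blaschke).prod
      = ((l.map fun a => φ * a * star φ).map blaschke).prod * C φ := by
  induction l with
  | nil => simp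
  | cons a l ih =>
    simp only [List.map_cons, List.prod_cons]
    rw [← mul_assoc, C_mul_blaschke hφ, mul_assoc (blaschke _), ih, ← mul_assoc]

theorem isFiniteBlaschke_sharp {B : QSeries} (h : IsFiniteBlaschke B) :
    IsFiniteBlaschke (sharp B) := by
  obtain ⟨P, hP, φ, hφ, rfl⟩ := h
  obtain ⟨l, hl, e⟩ := isBlaschkeProd_sharp hP
  have hφ' : ‖star φ‖ = 1 := by rwa [norm_star]
  refine ⟨_, ⟨l.map fun a => star φ * a * star (star φ), fun b hb => ?_, rfl⟩, star φ, hφ', ?_⟩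
  · obtain ⟨c, hc, rfl⟩ := List.mem_map.1 hb
    rw [norm_mul, norm_mul, star_star, norm_star, hφ, one_mul, mul_one]
    exact hl c hc
  · rw [sharp_mul, sharp_C, e, C_mul_prod hφ']

theorem ZerosIn.sharp {B : QSeries} {a : ℍ[ℝ]} (h : ZerosIn B (simClass a)) :
    ZerosIn (sharp B) (simClass a) := fun _ hγ =>
  star_mem_simClass.1 (h _ (isZero_sharp_iff.1 hγ))

theorem IsLeftBlaschkeDivisor.sharp {f B : QSeries} {a : ℍ[ℝ]}
    (h : IsLeftBlaschkeDivisor f (simClass a) B) :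
    IsRightBlaschkeDivisor (sharp f) (simClass a) (sharp B) := by
  obtain ⟨h1, h2, H, hH, hz, rfl⟩ := h
  exact ⟨isFiniteBlaschke_sharp h1, h2.sharp, _, hH.sharp, hz.sharp, sharp_mul _ _⟩

theorem IsRightBlaschkeDivisor.sharp {f B : QSeries} {a : ℍ[ℝ]}
    (h : IsRightBlaschkeDivisor f (simClass a) B) :
    IsLeftBlaschkeDivisor (sharp f) (simClass a) (sharp B) := by
  obtain ⟨h1, h2, H, hH, hz, rfl⟩ := h
  exact ⟨isFiniteBlaschke_sharp h1, h2.sharp, _, hH.sharp, hz.sharp, sharp_mul _ _⟩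

/-- A left Blaschke divisor is determined by the factorization of `f`. -/
theorem prod_eq_of_isLeftBlaschkeDivisor {a : ℍ[ℝ]} (ha : ‖a‖ < 1) {l l' : List ℍ[ℝ]}
    (hl : ∀ b ∈ l, b ∈ simClass a) (hl' : ∀ b ∈ l', ‖b‖ < 1) {H H' : QSeries}
    (hH : IsSchur H) (hz : NoZerosIn H (simClass a)) (hH' : IsSchur H')
    (hz' : NoZerosIn H' (simClass a)) {φ : ℍ[ℝ]} (hφ : ‖φ‖ = 1)
    (hV : ZerosIn ((l'.map blaschke).prod * C φ) (simClass a))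
    (h : (l.map blaschke).prod * H = (l'.map blaschke).prod * C φ * H') :
    (l'.map blaschke).prod = (l.map blaschke).prod := by
  have hφ0 : φ ≠ 0 := fun h0 => by simp [h0] at hφ
  rw [mul_assoc] at h
  exact (prod_eq_prod_of_mul_eq ha hH.convergesInBall
    ((convergesInBall_C φ).mul hH'.convergesInBall) hz
    ((noZerosIn_C ha hφ0).mul (convergesInBall_C φ) hH'.convergesInBall ha hz') hl
    (mem_simClass_of_zerosIn hl' hV) h).symm

theorem IsSphericalChain.map_star {a : ℍ[ℝ]} {l : List ℍ[ℝ]}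
    (h : IsSphericalChain (simClass a) l) : IsSphericalChain (simClass a) (l.map star) := by
  refine ⟨fun b hb => ?_, ?_⟩
  · obtain ⟨c, hc, rfl⟩ := List.mem_map.1 hb
    exact star_mem_simClass.2 (h.1 c hc)
  · rw [List.isChain_map]
    exact h.2.imp fun x y hxy hne => hxy (star_injective hne)

/-- The assertions about the left Blaschke divisor of a Schur-class series. -/
theorem exists_leftBlaschkeDivisor (f : QSeries) (hf : IsSchur f) (hf0 : f ≠ 0) (α : ℍ[ℝ])
    (hV : ∃ γ ∈ simClass α, IsZero f γ) :
    ∃ B : QSeries, (IsBlaschkeProd B ∧ IsLeftBlaschkeDivisor f (simClass α) B) ∧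
      (∀ B' : QSeries, IsBlaschkeProd B' → IsLeftBlaschkeDivisor f (simClass α) B' → B' = B) ∧
      (∀ B' : QSeries, IsLeftBlaschkeDivisor f (simClass α) B' →
        ∃ φ : ℍ[ℝ], ‖φ‖ = 1 ∧ B' = B * C φ) ∧
      (∀ x : ℝ, α = (x : ℍ[ℝ]) → (∃ n : ℕ, 0 < n ∧ HasRealMult f x n) ∧
        ∀ n : ℕ, HasRealMult f x n → B = blaschke (x : ℍ[ℝ]) ^ n) ∧
      ((∀ x : ℝ, α ≠ (x : ℍ[ℝ])) →
        (∃ κ m : ℕ, HasSphMult f α κ ∧ HasSphMult (f * sharp f) α m ∧ 2 * κ ≤ m ∧ 0 < m) ∧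
        (∀ κ : ℕ, HasSphMult f α κ → HasSphMult (f * sharp f) α (2 * κ) →
          B = sphBlaschke α ^ κ) ∧
        (∀ κ k : ℕ, HasSphMult f α κ → HasSphMult (f * sharp f) α (2 * κ + k) →
          ∃! l : List ℍ[ℝ], l.length = k ∧ IsSphericalChain (simClass α) l ∧
            B = sphBlaschke α ^ κ * (l.map blaschke).prod)) := by
  have hα : ‖α‖ < 1 := by
    obtain ⟨γ, hγ, h | h⟩ := hV <;> rw [← norm_eq_of_mem_simClass hγ] <;> exact h.1
  obtain ⟨l, hl, H, hH, hz, e⟩ := exists_eq_prod_mul hf hf0 hα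
  have hHc := hH.convergesInBall
  have hl1 : ∀ b ∈ l, ‖b‖ < 1 := fun b hb => by rwa [norm_eq_of_mem_simClass (hl b hb)]
  have hpos : 0 < l.length := by
    refine List.length_pos_iff.2 fun h0 => ?_
    obtain ⟨γ, hγ, h⟩ := hV
    rw [h0, List.map_nil, List.prod_nil, one_mul] at e
    exact hz γ hγ (e ▸ h)
  have hBP : IsBlaschkeProd (l.map blaschke).prod := ⟨l, hl1, rfl⟩
  refine ⟨(l.map blaschke).prod,
    ⟨hBP, ⟨_, hBP, 1, norm_one, by simp⟩, zerosIn_prod hα hl, H, hH, hz, e⟩, ?_, ?_, ?_, ?_⟩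
  · rintro B' ⟨l', hl', rfl⟩ ⟨-, hB, H', hH', hz', e'⟩
    refine prod_eq_of_isLeftBlaschkeDivisor hα hl hl' hH hz hH' hz' (φ := 1) norm_one ?_ ?_
    · simpa using hB
    · rw [← e, e']; simp
  · rintro B' ⟨⟨P, ⟨l', hl', rfl⟩, φ, hφ, rfl⟩, hB, H', hH', hz', e'⟩
    exact ⟨φ, hφ, by
      rw [prod_eq_of_isLeftBlaschkeDivisor hα hl hl' hH hz hH' hz' hφ hB (e.symm.trans e')]⟩
  · rintro x rfl
    have hp : (l.map blaschke).prod = blaschke (x : ℍ[ℝ]) ^ l.length := by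
      conv_lhs => rw [List.eq_replicate_iff.2 ⟨rfl, fun b hb => simClass_coe.1 (hl b hb)⟩]
      rw [List.map_replicate, List.prod_replicate]
    have hm : HasRealMult f x l.length := by
      rw [e, hp]; exact hasRealMult_blaschke_pow_mul hα hHc hz _
    exact ⟨⟨_, hpos, hm⟩, fun n hn => by rw [hp, hm.unique hα hn]⟩
  · intro hre
    obtain ⟨κ₀, c, hc, hlen, hp⟩ := exists_chain hl
    have hκ : HasSphMult f α κ₀ := by
      rw [e, hp]; exact hasSphMult_of_eq_sphBlaschke_pow_mul hα hre hHc hz hc κ₀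
    -- Here `f f♯ = ℬ_V ^ l.length * (H H♯)` with `H H♯` zero-free in the class: the empty chain
    -- applies.
    have hm : HasSphMult (f * sharp f) α l.length := by
      have h1 := hasSphMult_of_eq_sphBlaschke_pow_mul hα hre (hHc.mul hHc.sharp)
        (hz.mul hHc hHc.sharp hα hz.sharp) (c := []) ⟨by simp, by simp⟩ l.length
      rw [e, mul_sharp_mul, blaschke_prod_mul_sharp hl]
      simpa using h1
    refine ⟨⟨κ₀, l.length, hκ, hm, by omega, hpos⟩, fun κ h1 h2 => ?_, fun κ k h1 h2 => ?_⟩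
    · obtain rfl := hκ.unique hα hre h1
      have h3 := hm.unique hα hre h2
      have h4 : c = [] := List.length_eq_zero_iff.1 (by omega)
      rw [hp, h4]; simp
    · obtain rfl := hκ.unique hα hre h1
      have h3 := hm.unique hα hre h2
      refine ⟨c, ⟨by omega, hc, hp⟩, ?_⟩
      rintro c' ⟨-, hc', e'⟩
      have h5 := mul_left_cancel₀ (pow_ne_zero κ₀ (sphBlaschke_ne_zero α)) (e'.symm.trans hp)
      exact chain_eq_of_mul_eq hα hHc hHc hz hz hc' hc (by rw [h5])

end QSchur

theorem theorem3 (f : QSeries) (hf : IsSchur f) (hf0 : f ≠ 0) (α : ℍ[ℝ])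
    (hV : ∃ γ ∈ simClass α, IsZero f γ) :
    ∃ Bl Br : QSeries,
      -- existence
      (IsBlaschkeProd Bl ∧ IsLeftBlaschkeDivisor f (simClass α) Bl) ∧
      (IsBlaschkeProd Br ∧ IsRightBlaschkeDivisor f (simClass α) Br) ∧
      -- uniqueness
      (∀ B : QSeries, IsBlaschkeProd B → IsLeftBlaschkeDivisor f (simClass α) B → B = Bl) ∧
      (∀ B : QSeries, IsBlaschkeProd B → IsRightBlaschkeDivisor f (simClass α) B → B = Br) ∧
      -- uniqueness up to a unimodular constant without the normalization
      (∀ B : QSeries, IsLeftBlaschkeDivisor f (simClass α) B →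
        ∃ φ : ℍ[ℝ], ‖φ‖ = 1 ∧ B = Bl * PowerSeries.C φ) ∧
      (∀ B : QSeries, IsRightBlaschkeDivisor f (simClass α) B →
        ∃ φ : ℍ[ℝ], ‖φ‖ = 1 ∧ B = PowerSeries.C φ * Br) ∧
      -- the class of a real point
      (∀ x : ℝ, α = (x : ℍ[ℝ]) →
        (∃ n : ℕ, 0 < n ∧ HasRealMult f x n) ∧
        ∀ n : ℕ, HasRealMult f x n →
          Bl = blaschke (x : ℍ[ℝ]) ^ n ∧ Br = blaschke (x : ℍ[ℝ]) ^ n) ∧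
      -- the class of a non-real point
      ((∀ x : ℝ, α ≠ (x : ℍ[ℝ])) →
        (∃ κ m : ℕ, HasSphMult f α κ ∧ HasSphMult (f * sharp f) α m ∧ 2 * κ ≤ m ∧ 0 < m) ∧
        (∀ κ : ℕ, 0 < κ → HasSphMult f α κ → HasSphMult (f * sharp f) α (2 * κ) →
          Bl = sphBlaschke α ^ κ ∧ Br = sphBlaschke α ^ κ) ∧
        (∀ κ k : ℕ, 0 < k → HasSphMult f α κ → HasSphMult (f * sharp f) α (2 * κ + k) →
          (∃! l : List ℍ[ℝ], l.length = k ∧ IsSphericalChain (simClass α) l ∧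
            Bl = sphBlaschke α ^ κ * (l.map blaschke).prod) ∧
          (∃! l : List ℍ[ℝ], l.length = k ∧ IsSphericalChain (simClass α) l ∧
            Br = (l.reverse.map blaschke).prod * sphBlaschke α ^ κ))) := by
  have hsf0 : sharp f ≠ 0 := fun h => hf0 (by rw [← sharp_sharp f, h, sharp_zero])
  have hsV : ∃ γ ∈ simClass α, IsZero (sharp f) γ := by
    obtain ⟨γ, hγ, h⟩ := hV
    exact ⟨star γ, star_mem_simClass.2 hγ, isZero_sharp_iff.2 (by rwa [star_star])⟩
  obtain ⟨Bl, hB, hu, hφ, hx, hs⟩ := exists_leftBlaschkeDivisor f hf hf0 α hV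
  -- The right divisor is the image under the involution of the left divisor of `f♯`. The
  -- multiplicities to compare are unchanged, as `f♯ f = f f♯`.
  obtain ⟨Bs, hB', hu', hφ', hx', hs'⟩ :=
    exists_leftBlaschkeDivisor (sharp f) hf.sharp hsf0 α hsV
  have hN : sharp f * sharp (sharp f) = f * sharp f := by rw [sharp_sharp, sharp_mul_self]
  rw [hN] at hs'
  have hBs : IsRightBlaschkeDivisor f (simClass α) (sharp Bs) := by
    simpa using hB'.2.sharp
  refine ⟨Bl, sharp Bs, hB, ⟨isBlaschkeProd_sharp hB'.1, hBs⟩, hu, ?_, hφ, ?_, ?_, ?_⟩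
  · intro B h1 h2
    rw [← hu' _ (isBlaschkeProd_sharp h1) h2.sharp, sharp_sharp]
  · intro B h
    obtain ⟨φ, h1, h2⟩ := hφ' _ h.sharp
    exact ⟨star φ, by rwa [norm_star], by rw [← sharp_sharp B, h2, sharp_mul, sharp_C]⟩
  · intro x hαx
    refine ⟨(hx x hαx).1, fun n hn => ⟨(hx x hαx).2 n hn, ?_⟩⟩
    rw [(hx' x hαx).2 n hn.sharp, sharp_pow, sharp_blaschke, Quaternion.star_coe]
  · intro hre
    obtain ⟨h1, h2, h3⟩ := hs hre
    obtain ⟨-, h2', h3'⟩ := hs' hre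
    refine ⟨h1, fun κ _ hκ hm => ⟨h2 κ hκ hm, ?_⟩, fun κ k _ hκ hm => ⟨h3 κ k hκ hm, ?_⟩⟩
    · rw [h2' κ hκ.sharp hm, sharp_pow, sharp_sphBlaschke]
    -- The involution conjugates and reverses. With the reversed order in the statement, the right
    -- chain is the entrywise conjugate of the left chain of `f♯`.
    · have hprod : ∀ l : List ℍ[ℝ],
          sharp ((l.reverse.map blaschke).prod * sphBlaschke α ^ κ)
            = sphBlaschke α ^ κ * ((l.map star).map blaschke).prod := by
        intro l
        rw [sharp_mul, sharp_pow, sharp_sphBlaschke, sharp_blaschke_prod, List.map_reverse (f := star),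
          List.reverse_reverse]
      have hss : ∀ l : List ℍ[ℝ], (l.map star).map star = l := fun l => by
        simp [List.map_map, Function.comp_def]
      obtain ⟨l, ⟨hlen, hc, e⟩, huniq⟩ := h3' κ k hκ.sharp hm
      refine ⟨l.map star, ⟨by simpa using hlen, hc.map_star, sharp_injective ?_⟩, ?_⟩
      · rw [hprod, hss, sharp_sharp, e]
      · rintro l' ⟨hlen', hc', e'⟩
        have h4 := huniq (l'.map star) ⟨by simpa using hlen', hc'.map_star, by
          rw [← hprod, ← e', sharp_sharp]⟩
        rw [← h4, hss]
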